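/- Let $\mathbf{P}$ be a coloured symmetric operad in sets which is \emph{closed}: for each colour $c$ the set of operations without inputs and with output $c$ is a singleton. A right $\mathbf{P}$-module $M$ consists of sets $M(c_1,\dots,c_n)$ for all finite families of colours (including $n=0$), with symmetric group actions and a unital, associative and equivariant right action of $\mathbf{P}$; $\mathsf{RMod}_{\mathbf{P}}$ is the category of right $\mathbf{P}$-modules. Let $\mathsf{For}$ be the category of forests. Its objects are finite families $F=\bigoplus_{i\in I}T_i$ of finite rooted non-planar trees. A morphism $\bigoplus_{i\in I} T_i\to\bigoplus_{j\in J} S_j$ is a map $f\colon I\to J$ with operad maps $\alpha_i\colon\Omega(T_i)\to\Omega(S_{f(i)})$, where $\Omega(T)$ is the operad freely generated by the vertices of $T$, such that for $a\neq b$ with $f(a)=f(b)$ no edge in the image of $\alpha_a$ is comparable with an edge in the image of $\alpha_b$. Let $\mathsf{fSets}$ be the category of presheaves of sets on $\mathsf{For}$, and $N\mathbf{P}\in\mathsf{fSets}$ the forest nerve, $N\mathbf{P}_{\bigoplus_{i} T_i}=\prod_{i}\mathsf{Op}(\Omega(T_i),\mathbf{P})$. For a forest $F$ with components indexed by $I$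 let $\rho(F)$ be the forest of its root edges, and put $M(\rho(F))=\coprod_{(c_i)_{i\in I}}M((c_i)_{i\in I})$, which maps to $N\mathbf{P}_{\rho(F)}$ by remembering the colours. Let $$N_{\mathbf{P}}\colon\mathsf{RMod}_{\mathbf{P}}\to\mathsf{fSets}_{/N\mathbf{P}},\qquad (N_{\mathbf{P}}M)_F=N\mathbf{P}_F\times_{N\mathbf{P}_{\rho(F)}}M(\rho(F)).$$ A morphism $F\to G$ sends $(a,m)\in (N_{\mathbf{P}}M)_G$ to $(a|_F,m')$, where $m'$ is obtained by acting on $m$, for each root $r$ of $G$, with the composite of the operations of $a$ between $r$ and the images of the roots of $F$ above $r$, all remaining inputs being filled with the constants of $\mathbf{P}$. Then: (1) The square expressing $(N_{\mathbf{P}}M)_F$ as the pullback of $M(\rho(F))\to N\mathbf{P}_{\rho(F)}$ along the map $N\mathbf{P}_F\to N\mathbf{P}_{\rho(F)}$ induced by the inclusion $\rho(F)\to F$ is cartesian, for every right $\mathbf{P}$-module $M$ and every forest $F$. (2) $N_{\mathbf{P}}$ has a left adjoint. (3) For every left adjoint $\tau_{\mathbf{P}}$ of $N_{\mathbf{P}}$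 (with a chosen adjunction) and every representable object $\alpha\colon F\to N\mathbf{P}$, there is an isomorphism from $\tau_{\mathbf{P}}(\alpha)$ to the free right $\mathbf{P}$-module on one generator $m_{\mathrm{gen}}$ with colours $\alpha(r)$, $r$ ranging over the roots of $F$; its set of elements with colours $(d_j)_{j\in J}$ consists of the maps $f\colon J\to I$ together with operations $p_i\in\mathbf{P}((d_j)_{j\in f^{-1}(i)};\alpha(r_i))$, $i\in I$. Under this isomorphism the unit $F\to N_{\mathbf{P}}\tau_{\mathbf{P}}(\alpha)$ of the adjunction corresponds to the element $(\alpha,m_{\mathrm{gen}})$. (4) $\mathsf{RMod}_{\mathbf{P}}$ has all small coproducts and $N_{\mathbf{P}}$ preserves them. -/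

import Mathlib

open CategoryTheory

-- Sets are types in `Type (max 1 u)`, index sets of inputs and components are finite types in `Type`.
universe u w

/-- A coloured symmetric operad in sets, with operations indexed by finite sets of inputs:
for a finite set `I`, a family of colours `c : I → Col` and a colour `e` there is a set
`Op c e` of operations with inputs `c i` (`i ∈ I`) and output `e`.  Bijections act by relabelling
the inputs (this is the symmetric group action), there are identities, and there is a composition
`p ∘ (qᵢ)ᵢ`, whose set of inputs is the disjoint union of the sets of inputs of the `qᵢ`. -/
structure Operad where
  Col : Type u
  Op : ∀ {I : Type} [Finite I], (I → Col) → Col → Type u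
  relabel : ∀ {I J : Type} [Finite I] [Finite J] (σ : I ≃ J) {c : I → Col} {d : J → Col} {e : Col},
    Op c e → (∀ i, d (σ i) = c i) → Op d e
  one : ∀ c : Col, Op (fun _ : Unit => c) c
  comp : ∀ {I : Type} {J : I → Type} [Finite I] [∀ i, Finite (J i)] {c : I → Col}
    {d : ∀ i, J i → Col} {e : Col}, Op c e → (∀ i, Op (d i) (c i)) →
      Op (fun x : Σ i, J i => d x.1 x.2) e
  relabel_refl : ∀ {I : Type} [Finite I] {c : I → Col} {e : Col} (p : Op c e),
    relabel (Equiv.refl I) p (fun _ => rfl) = p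
  relabel_trans : ∀ {I J K : Type} [Finite I] [Finite J] [Finite K] (σ : I ≃ J) (τ : J ≃ K)
    {c : I → Col} {d : J → Col} {k : K → Col} {e : Col} (h : ∀ i, d (σ i) = c i)
    (h' : ∀ j, k (τ j) = d j) (p : Op c e),
    relabel τ (relabel σ p h) h' = relabel (σ.trans τ) p (fun i => (h' (σ i)).trans (h i))
  /-- Equivariance of the composition in the inner operations. -/
  comp_relabel : ∀ {I : Type} {J J' : I → Type} [Finite I] [∀ i, Finite (J i)]
    [∀ i, Finite (J' i)] (τ : ∀ i, J i ≃ J' i) {c : I → Col} {d : ∀ i, J i → Col}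
    {d' : ∀ i, J' i → Col} {e : Col} (h : ∀ i j, d' i (τ i j) = d i j) (p : Op c e)
    (q : ∀ i, Op (d i) (c i)),
    comp p (fun i => relabel (τ i) (q i) (h i)) =
      relabel (Equiv.sigmaCongrRight τ) (comp p q) (fun x => h x.1 x.2)
  /-- Equivariance of the composition in the outer operation. -/
  relabel_comp : ∀ {I I' : Type} {J : I' → Type} [Finite I] [Finite I'] [∀ i, Finite (J i)]
    (σ : I ≃ I') {c : I' → Col} {d : ∀ i, J i → Col} {e : Col} (p : Op (fun i => c (σ i)) e)
    (q : ∀ i, Op (d i) (c i)),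
    comp (relabel σ (d := c) p (fun _ => rfl)) q =
      relabel (Equiv.sigmaCongrLeft σ) (comp p (fun i => q (σ i))) (fun _ => rfl)
  comp_assoc : ∀ {I : Type} {J : I → Type} {K : ∀ i, J i → Type} [Finite I] [∀ i, Finite (J i)]
    [∀ i j, Finite (K i j)] {c : I → Col} {d : ∀ i, J i → Col} {k : ∀ i j, K i j → Col} {e : Col}
    (p : Op c e) (q : ∀ i, Op (d i) (c i)) (r : ∀ i j, Op (k i j) (d i j)),
    relabel (Equiv.sigmaAssoc K) (d := fun x => k x.1 x.2.1 x.2.2)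
        (comp (comp p q) (fun x : Σ i, J i => r x.1 x.2)) (fun _ => rfl) =
      comp p (fun i => comp (q i) (r i))
  comp_one : ∀ {I : Type} [Finite I] {c : I → Col} {e : Col} (p : Op c e),
    relabel (Equiv.sigmaUnique I (fun _ => Unit)) (d := c) (comp p (fun i => one (c i)))
      (fun _ => rfl) = p
  one_comp : ∀ {J : Type} [Finite J] {d : J → Col} {c : Col} (q : Op d c),
    relabel (Equiv.uniqueSigma (fun _ : Unit => J)) (d := d) (comp (one c) (fun _ : Unit => q))
      (fun _ => rfl) = q

namespace Operad

/-- An operad is closed if every colour has exactly one constant (operation without inputs). -/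
def IsClosed (P : Operad.{u}) : Prop :=
  ∀ c : P.Col, Nonempty (Unique (P.Op (fun i : Empty => i.elim) c))

/-- Morphisms of coloured operads. -/
structure Hom (Q : Operad.{w}) (P : Operad.{u}) where
  col : Q.Col → P.Col
  op : ∀ {I : Type} [Finite I] {c : I → Q.Col} {e : Q.Col},
    Q.Op c e → P.Op (fun i => col (c i)) (col e)
  op_relabel : ∀ {I J : Type} [Finite I] [Finite J] (σ : I ≃ J) {c : I → Q.Col} {d : J → Q.Col}
    {e : Q.Col} (h : ∀ i, d (σ i) = c i) (p : Q.Op c e),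
    op (Q.relabel σ p h) = P.relabel σ (op p) (fun i => congrArg col (h i))
  op_one : ∀ c : Q.Col, op (Q.one c) = P.one (col c)
  op_comp : ∀ {I : Type} {J : I → Type} [Finite I] [∀ i, Finite (J i)] {c : I → Q.Col}
    {d : ∀ i, J i → Q.Col} {e : Q.Col} (p : Q.Op c e) (q : ∀ i, Q.Op (d i) (c i)),
    op (Q.comp p q) = P.comp (op p) (fun i => op (q i))

/-- The identity morphism. -/
def Hom.id (P : Operad.{u}) : Hom P P where
  col c := c
  op p := p
  op_relabel _ _ _ _ _ _ := rfl
  op_one _ := rfl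
  op_comp _ _ := rfl

/-- Composition of morphisms (`a.comp b` is `a` after `b`). -/
def Hom.comp {R : Operad.{0}} {Q : Operad.{w}} {P : Operad.{u}} (a : Hom Q P) (b : Hom R Q) :
    Hom R P where
  col c := a.col (b.col c)
  op p := a.op (b.op p)
  op_relabel σ _ _ _ _ p := by rw [b.op_relabel, a.op_relabel]
  op_one c := by rw [b.op_one, a.op_one]
  op_comp p q := by rw [b.op_comp, a.op_comp]

end Operad

/-- A right module over `P`: sets `obj c` for finite families of colours `c`, with relabelling
along bijections and a unital, associative and equivariant right action of `P`. -/
structure RightModule (P : Operad.{u}) where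
  obj : ∀ {I : Type} [Finite I], (I → P.Col) → Type w
  relabel : ∀ {I J : Type} [Finite I] [Finite J] (σ : I ≃ J) {c : I → P.Col} {d : J → P.Col},
    obj c → (∀ i, d (σ i) = c i) → obj d
  act : ∀ {I : Type} {J : I → Type} [Finite I] [∀ i, Finite (J i)] {c : I → P.Col}
    {d : ∀ i, J i → P.Col}, obj c → (∀ i, P.Op (d i) (c i)) → obj (fun x : Σ i, J i => d x.1 x.2)
  relabel_refl : ∀ {I : Type} [Finite I] {c : I → P.Col} (m : obj c),
    relabel (Equiv.refl I) m (fun _ => rfl) = m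
  relabel_trans : ∀ {I J K : Type} [Finite I] [Finite J] [Finite K] (σ : I ≃ J) (τ : J ≃ K)
    {c : I → P.Col} {d : J → P.Col} {k : K → P.Col} (h : ∀ i, d (σ i) = c i)
    (h' : ∀ j, k (τ j) = d j) (m : obj c),
    relabel τ (relabel σ m h) h' = relabel (σ.trans τ) m (fun i => (h' (σ i)).trans (h i))
  act_relabel : ∀ {I : Type} {J J' : I → Type} [Finite I] [∀ i, Finite (J i)]
    [∀ i, Finite (J' i)] (τ : ∀ i, J i ≃ J' i) {c : I → P.Col} {d : ∀ i, J i → P.Col}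
    {d' : ∀ i, J' i → P.Col} (h : ∀ i j, d' i (τ i j) = d i j) (m : obj c)
    (q : ∀ i, P.Op (d i) (c i)),
    act m (fun i => P.relabel (τ i) (q i) (h i)) =
      relabel (Equiv.sigmaCongrRight τ) (act m q) (fun x => h x.1 x.2)
  relabel_act : ∀ {I I' : Type} {J : I' → Type} [Finite I] [Finite I'] [∀ i, Finite (J i)]
    (σ : I ≃ I') {c : I' → P.Col} {d : ∀ i, J i → P.Col} (m : obj (fun i => c (σ i)))
    (q : ∀ i, P.Op (d i) (c i)),
    act (relabel σ (d := c) m (fun _ => rfl)) q =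
      relabel (Equiv.sigmaCongrLeft σ) (act m (fun i => q (σ i))) (fun _ => rfl)
  act_act : ∀ {I : Type} {J : I → Type} {K : ∀ i, J i → Type} [Finite I] [∀ i, Finite (J i)]
    [∀ i j, Finite (K i j)] {c : I → P.Col} {d : ∀ i, J i → P.Col} {k : ∀ i j, K i j → P.Col}
    (m : obj c) (q : ∀ i, P.Op (d i) (c i)) (r : ∀ i j, P.Op (k i j) (d i j)),
    relabel (Equiv.sigmaAssoc K) (d := fun x => k x.1 x.2.1 x.2.2)
        (act (act m q) (fun x : Σ i, J i => r x.1 x.2)) (fun _ => rfl) =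
      act m (fun i => P.comp (q i) (r i))
  act_one : ∀ {I : Type} [Finite I] {c : I → P.Col} (m : obj c),
    relabel (Equiv.sigmaUnique I (fun _ => Unit)) (d := c) (act m (fun i => P.one (c i)))
      (fun _ => rfl) = m

namespace RightModule

variable {P : Operad.{u}}

/-- Morphisms of right modules: families of maps compatible with relabelling and the action. -/
@[ext]
structure Hom (M N : RightModule.{u, w} P) where
  app : ∀ {I : Type} [Finite I] (c : I → P.Col), M.obj c → N.obj c
  app_relabel : ∀ {I J : Type} [Finite I] [Finite J] (σ : I ≃ J) {c : I → P.Col} {d : J → P.Col}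
    (h : ∀ i, d (σ i) = c i) (m : M.obj c), app d (M.relabel σ m h) = N.relabel σ (app c m) h
  app_act : ∀ {I : Type} {J : I → Type} [Finite I] [∀ i, Finite (J i)] {c : I → P.Col}
    {d : ∀ i, J i → P.Col} (m : M.obj c) (q : ∀ i, P.Op (d i) (c i)),
    app _ (M.act m q) = N.act (app c m) q

instance : Category (RightModule.{u, w} P) where
  Hom M N := Hom M N
  id M := { app := fun _ m => m, app_relabel := fun _ _ _ _ _ => rfl, app_act := fun _ _ => rfl }
  comp f g :=
    { app := fun c m => g.app c (f.app c m)
      app_relabel := fun σ _ _ h m => by rw [f.app_relabel, g.app_relabel]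
      app_act := fun m q => by rw [f.app_act, g.app_act] }

end RightModule

/-- Finite rooted (non-planar) trees, presented by their finite set of edges. The order is the one
in which `e ≤ f` if the path from `f` to the root contains `e`; the root is the least edge.
A vertex is recorded by its outgoing edge: the vertices are the edges which are
not leaves, and the incoming edges of the vertex with outgoing edge `e` are the edges covering `e`.
A maximal edge that is not a leaf carries a stump. -/
structure OperadicTree : Type 1 where
  Edge : Type
  [finite : Finite Edge]
  [order : PartialOrder Edge]
  root : Edge
  root_le : ∀ e, root ≤ e
  total_below : ∀ e f g : Edge, e ≤ g → f ≤ g → e ≤ f ∨ f ≤ e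
  leaf : Set Edge
  leaf_isMax : ∀ e ∈ leaf, IsMax e

attribute [instance] OperadicTree.finite OperadicTree.order

namespace OperadicTree

variable {T : OperadicTree}

/-- `T.IsSubtree A e`: the edge `e` is the root and `A` is the set of leaves of a subtree of `T`.
Subtrees are either single edges or obtained by grafting subtrees on all the
incoming edges of a vertex. -/
inductive IsSubtree (T : OperadicTree) : Set T.Edge → T.Edge → Prop
  | edge (e : T.Edge) : IsSubtree T {e} e
  | graft (e : T.Edge) (he : e ∉ T.leaf) (A : {f // e ⋖ f} → Set T.Edge)
      (hA : ∀ f, IsSubtree T (A f) f.1) : IsSubtree T (⋃ f, A f) e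

theorem IsSubtree.le {A : Set T.Edge} {e : T.Edge} (h : T.IsSubtree A e) : ∀ a ∈ A, e ≤ a := by
  induction h with
  | edge e => rintro a rfl; exact le_rfl
  | graft e he A hA ih =>
    intro a ha
    obtain ⟨f, hf⟩ := Set.mem_iUnion.1 ha
    exact f.2.le.trans (ih f a hf)

theorem eq_of_covBy {e f f' g : T.Edge} (h : e ⋖ f) (h' : e ⋖ f') (hg : f ≤ g) (hg' : f' ≤ g) :
    f = f' := by
  rcases T.total_below f f' g hg hg' with h1 | h1
  · exact h1.eq_or_lt.elim id (fun h2 => absurd h2 (h'.2 h.1))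
  · exact h1.eq_or_lt.elim Eq.symm (fun h2 => absurd h2 (h.2 h'.1))

theorem IsSubtree.antichain {A : Set T.Edge} {e : T.Edge} (h : T.IsSubtree A e) :
    ∀ a ∈ A, ∀ b ∈ A, a ≤ b → a = b := by
  induction h with
  | edge e => rintro a rfl b rfl _; rfl
  | graft e he A hA ih =>
    intro a ha b hb hab
    obtain ⟨f, hf⟩ := Set.mem_iUnion.1 ha
    obtain ⟨g, hg⟩ := Set.mem_iUnion.1 hb
    have : f = g := Subtype.ext
      (eq_of_covBy f.2 g.2 (((hA f).le a hf).trans hab) ((hA g).le b hg))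
    subst this
    exact ih f a hf b hg hab

theorem IsSubtree.bind {A : Set T.Edge} {e : T.Edge} (h : T.IsSubtree A e)
    (B : T.Edge → Set T.Edge) (hB : ∀ a ∈ A, T.IsSubtree (B a) a) :
    T.IsSubtree (⋃ a ∈ A, B a) e := by
  induction h with
  | edge e => simpa using hB e rfl
  | graft e he A hA ih =>
    have := IsSubtree.graft e he (fun f => ⋃ a ∈ A f, B a)
      (fun f => ih f (fun a ha => hB a (Set.mem_iUnion.2 ⟨f, ha⟩)))
    convert this using 1
    ext x
    simp only [Set.mem_iUnion]
    constructor
    · rintro ⟨a, ⟨f, hf⟩, hx⟩; exact ⟨f, a, hf, hx⟩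
    · rintro ⟨f, a, hf, hx⟩; exact ⟨a, ⟨f, hf⟩, hx⟩

theorem IsSubtree.comp {I : Type} {J : I → Type} {x : I → T.Edge} {y : ∀ i, J i → T.Edge}
    {e : T.Edge} (hx : Function.Injective x ∧ T.IsSubtree (Set.range x) e)
    (hy : ∀ i, Function.Injective (y i) ∧ T.IsSubtree (Set.range (y i)) (x i)) :
    Function.Injective (fun s : Σ i, J i => y s.1 s.2) ∧
      T.IsSubtree (Set.range (fun s : Σ i, J i => y s.1 s.2)) e := by
  constructor
  · rintro ⟨i, j⟩ ⟨i', j'⟩ h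
    have h1 : x i ≤ y i j := (hy i).2.le _ ⟨j, rfl⟩
    have h2 : x i' ≤ y i j := by
      have := (hy i').2.le _ ⟨j', rfl⟩
      exact this.trans (le_of_eq h.symm)
    have : i = i' := by
      apply hx.1
      rcases T.total_below _ _ _ h1 h2 with h3 | h3
      · exact hx.2.antichain _ ⟨i, rfl⟩ _ ⟨i', rfl⟩ h3
      · exact (hx.2.antichain _ ⟨i', rfl⟩ _ ⟨i, rfl⟩ h3).symm
    subst this
    exact congrArg _ ((hy i).1 h)
  · have := hx.2.bind (fun a => {f | ∃ i j, x i = a ∧ y i j = f}) (by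
      rintro _ ⟨i, rfl⟩
      convert (hy i).2 using 1
      ext f
      constructor
      · rintro ⟨i', j, h, rfl⟩
        have := hx.1 h
        subst this
        exact ⟨j, rfl⟩
      · rintro ⟨j, rfl⟩
        exact ⟨i, j, rfl, rfl⟩)
    convert this using 1
    ext f
    simp only [Set.mem_range, Set.mem_iUnion, Set.mem_ofPred_eq]
    constructor
    · rintro ⟨⟨i, j⟩, rfl⟩; exact ⟨x i, ⟨i, rfl⟩, i, j, rfl, rfl⟩
    · rintro ⟨_, _, i, j, _, rfl⟩; exact ⟨⟨i, j⟩, rfl⟩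

/-- The operad `Ω(T)` of a tree: its colours are the edges of `T`, and there is exactly one
operation with inputs `x i` (`i ∈ I`) and output `e` if the `x i` are the distinct leaves
of a subtree of `T` with root `e`, and no such operation otherwise. -/
@[reducible] def operad (T : OperadicTree) : Operad.{0} where
  Col := T.Edge
  Op x e := PLift (Function.Injective x ∧ T.IsSubtree (Set.range x) e)
  relabel := fun {_ _ _ _} σ {c d e} p h => ⟨by
    have hc : c = d ∘ σ := funext fun i => (h i).symm
    subst hc
    refine ⟨fun a b hab => ?_, ?_⟩
    · have := @p.down.1 (σ.symm a) (σ.symm b) (by simpa using hab)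
      simpa using this
    · have := p.down.2
      rwa [σ.surjective.range_comp] at this⟩
  one c := ⟨fun _ _ _ => rfl, by simpa using IsSubtree.edge c⟩
  comp p q := ⟨IsSubtree.comp p.down (fun i => (q i).down)⟩
  relabel_refl _ := rfl
  relabel_trans _ _ := by intros; rfl
  comp_relabel := by intros; rfl
  relabel_comp := by intros; rfl
  comp_assoc _ _ _ := rfl
  comp_one _ := rfl
  one_comp _ := rfl

/-- The map on edges underlying a morphism of trees. -/
def edgeMap {S T : OperadicTree} (a : Operad.Hom S.operad T.operad) : S.Edge → T.Edge := a.col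

/-- The category of trees: the morphisms `S ⟶ T` are the operad maps `Ω(S) → Ω(T)`. -/
instance : Category OperadicTree where
  Hom S T := Operad.Hom S.operad T.operad
  id T := Operad.Hom.id T.operad
  comp a b := b.comp a

end OperadicTree

namespace Operad

variable {P : Operad.{u}}

theorem relabel_congr {I J : Type} [Finite I] [Finite J] {σ τ : I ≃ J} (h : ∀ i, σ i = τ i)
    {c : I → P.Col} {d : J → P.Col} {e : P.Col} (p : P.Op c e) (hσ : ∀ i, d (σ i) = c i)
    (hτ : ∀ i, d (τ i) = c i) : P.relabel σ p hσ = P.relabel τ p hτ := by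
  obtain rfl : σ = τ := Equiv.ext h
  rfl

theorem relabel_id {I : Type} [Finite I] {σ : I ≃ I} (h : ∀ i, σ i = i)
    {c : I → P.Col} {e : P.Col} (p : P.Op c e) (hσ : ∀ i, c (σ i) = c i) :
    P.relabel σ p hσ = p :=
  (relabel_congr h p _ _).trans (P.relabel_refl p)

theorem relabel_symm {I J : Type} [Finite I] [Finite J] {σ : I ≃ J}
    {c : I → P.Col} {d : J → P.Col} {e : P.Col} {p : P.Op c e} {q : P.Op d e}
    {hσ : ∀ i, d (σ i) = c i} (h : P.relabel σ p hσ = q) :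
    p = P.relabel σ.symm q (fun j => by rw [← hσ, σ.apply_symm_apply]) := by
  subst h
  rw [P.relabel_trans]
  exact (relabel_id (by simp) _ _).symm

/-- The identity operation, with its input indexed by a one-element set. -/
noncomputable def unitOn {I : Type} [Finite I] (i : I) (hi : ∀ j, j = i) {c : I → P.Col}
    {e : P.Col} (hc : c i = e) : P.Op c e :=
  P.relabel ⟨fun _ : Unit => i, fun _ => (), fun _ => rfl, fun j => (hi j).symm⟩ (P.one e)
    (fun _ => hc)

theorem comp_unitOn {I : Type} [Finite I] (i : I) (hi : ∀ j, j = i) {c : I → P.Col}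
    {J : I → Type} [∀ i, Finite (J i)] {d : ∀ i, J i → P.Col}
    (q : ∀ i, P.Op (d i) (c i)) (σ : J i ≃ Σ i, J i) (hσ : ∀ j, σ j = ⟨i, j⟩)  :
    P.comp (unitOn i hi rfl) q = P.relabel σ (q i) (fun j => by rw [hσ]) := by
  unfold unitOn
  refine (P.relabel_comp ⟨fun _ : Unit => i, fun _ => (), fun _ => rfl, fun j => (hi j).symm⟩
    (c := c) (P.one (c i)) q).trans ?_
  refine (congrArg (fun p => P.relabel _ p _) (relabel_symm (P.one_comp (q i)))).trans ?_
  refine (P.relabel_trans _ _ _ _ _).trans ?_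
  exact relabel_congr (fun j => by rw [hσ]; rfl) _ _ _

/-- The unique constant of a closed operad, with its inputs indexed by an empty set. -/
noncomputable def const (hP : P.IsClosed) {I : Type} [Finite I] (hI : IsEmpty I) (c : I → P.Col)
    (e : P.Col) : P.Op c e :=
  P.relabel (Equiv.equivOfIsEmpty Empty I) (hP e).some.default (fun i => i.elim)

theorem const_unique (hP : P.IsClosed) {I : Type} [Finite I] (hI : IsEmpty I) {c : I → P.Col}
    {e : P.Col} (p q : P.Op c e) : p = q := by
  have key : ∀ r : P.Op c e, r = P.relabel (Equiv.equivOfIsEmpty Empty I)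
      (P.relabel (Equiv.equivOfIsEmpty I Empty) (d := fun i : Empty => i.elim) r
        (fun i => hI.elim i)) (fun i => i.elim) := fun r => by
    rw [P.relabel_trans]
    exact (relabel_id (fun i => hI.elim i) _ _).symm
  rw [key p, key q]
  congr 1
  exact (hP e).some.eq_default _ |>.trans ((hP e).some.eq_default _).symm

end Operad

namespace OperadicTree

variable {T S : OperadicTree}

/-- The operation of `Ω(T)` given by the vertex with outgoing edge `e`. -/
def vertexOp (e : T.Edge) (he : e ∉ T.leaf) :
    T.operad.Op (fun f : {f // e ⋖ f} => f.1) e :=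
  ⟨Subtype.val_injective, by
    have := IsSubtree.graft e he (fun f => {f.1}) (fun f => .edge _)
    convert this using 1
    ext f; simp⟩

theorem notMem_leaf_of_lt {e f : T.Edge} (h : e < f) : e ∉ T.leaf :=
  fun he => (T.leaf_isMax e he).not_lt h

theorem exists_covBy_le {e f : T.Edge} (h : e < f) : ∃ g, e ⋖ g ∧ g ≤ f :=
  exists_covBy_le_of_lt h

theorem hom_mono (a : Operad.Hom S.operad T.operad) {e f : S.Edge} (h : e ≤ f) : edgeMap a e ≤ edgeMap a f := by
  induction e using (wellFounded_gt (α := S.Edge)).induction with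
  | _ e ih =>
    rcases h.eq_or_lt with rfl | h
    · exact le_rfl
    · obtain ⟨g, hg, hgf⟩ := exists_covBy_le h
      refine le_trans ?_ (ih g hg.lt hgf)
      exact (a.op (vertexOp e (notMem_leaf_of_lt h))).down.2.le _ ⟨⟨g, hg⟩, rfl⟩

theorem hom_reflects (a : Operad.Hom S.operad T.operad) {e f : S.Edge} (h : edgeMap a e ≤ edgeMap a f) : e ≤ f ∨ f ≤ e := by
  suffices H : ∀ g : S.Edge, g ≤ e → g ≤ f → e ≤ f ∨ f ≤ e from
    H S.root (S.root_le e) (S.root_le f)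
  intro g
  induction g using (wellFounded_gt (α := S.Edge)).induction with
  | _ g ih =>
    intro h1 h2
    rcases h1.eq_or_lt with rfl | h1
    · exact Or.inl h2
    rcases h2.eq_or_lt with rfl | h2
    · exact Or.inr h1.le
    obtain ⟨x, hx, hxe⟩ := exists_covBy_le h1
    obtain ⟨y, hy, hyf⟩ := exists_covBy_le h2
    have hv := (a.op (vertexOp g (notMem_leaf_of_lt h1))).down
    have hxy : edgeMap a x = edgeMap a y := by
      rcases T.total_below _ _ _ ((hom_mono a hxe).trans h) (hom_mono a hyf) with h3 | h3
      · exact hv.2.antichain _ ⟨⟨x, hx⟩, rfl⟩ _ ⟨⟨y, hy⟩, rfl⟩ h3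
      · exact (hv.2.antichain _ ⟨⟨y, hy⟩, rfl⟩ _ ⟨⟨x, hx⟩, rfl⟩ h3).symm
    have := hv.1 (a₁ := ⟨x, hx⟩) (a₂ := ⟨y, hy⟩) hxy
    obtain rfl : x = y := congrArg Subtype.val this
    exact ih x hx.lt hxe hyf

end OperadicTree

/-- `Adm x e`: the elements `x i` (`i ∈ I`) are pairwise incomparable, hence distinct, and lie
above `e`. -/
def Adm {E : Type} [Preorder E] {I : Type} (x : I → E) (e : E) : Prop :=
  (∀ i, e ≤ x i) ∧ ∀ i j, x i ≤ x j → i = j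

namespace OperadicTree

variable {T S : OperadicTree} {P : Operad.{u}}

theorem _root_.Adm.of_comp {E : Type} [Preorder E] {I : Type} {J : I → Type} {x : I → E}
    {e : E} {y : ∀ i, J i → E} (hE : ∀ e f g : E, e ≤ g → f ≤ g → e ≤ f ∨ f ≤ e)
    (hx : Adm x e) (hy : ∀ i, Adm (y i) (x i)) : Adm (fun s : Σ i, J i => y s.1 s.2) e := by
  refine ⟨fun s => (hx.1 _).trans ((hy _).1 _), ?_⟩
  rintro ⟨i, j⟩ ⟨i', j'⟩ h
  have : i = i' := by
    rcases hE _ _ _ (((hy i).1 j).trans h) ((hy i').1 j') with h3 | h3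
    · exact hx.2 _ _ h3
    · exact (hx.2 _ _ h3).symm
  subst this
  rw [(hy i).2 j j' h]

theorem _root_.Adm.branch {I : Type} {x : I → T.Edge} {e : T.Edge} (h : Adm x e)
    (f : T.Edge) : Adm (fun i : {i // f ≤ x i} => x i.1) f :=
  ⟨fun i => i.2, fun _ _ hij => Subtype.ext (h.2 _ _ hij)⟩

/-- Sorting edges strictly above `e` by the edges covering `e`. -/
noncomputable def branchEquiv {I : Type} (x : I → T.Edge) (e : T.Edge) (h : ∀ i, e < x i) :
    (Σ f : {f // e ⋖ f}, {i // f.1 ≤ x i}) ≃ I :=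
  Equiv.ofBijective (fun s => s.2.1) ⟨by
    rintro ⟨f, i, hi⟩ ⟨f', i', hi'⟩ h
    obtain rfl : i = i' := h
    obtain rfl : f = f' := Subtype.ext (eq_of_covBy f.2 f'.2 hi hi')
    rfl, fun i => by
    obtain ⟨f, hf, hfi⟩ := exists_covBy_le (h i)
    exact ⟨⟨⟨f, hf⟩, i, hfi⟩, rfl⟩⟩

theorem Adm_lt {I : Type} {x : I → T.Edge} {e : T.Edge} (h : Adm x e) (hx : ¬ ∃ i, x i = e) :
    ∀ i, e < x i := fun i => lt_of_le_of_ne (h.1 i) (fun h' => hx ⟨i, h'.symm⟩)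

open Classical in
/-- Let `P` be closed and `a : Ω(T) → P`. For pairwise incomparable edges `x i` above `e`,
the operation of `P` with inputs the colours of the `x i` and output the colour of `e` that is
obtained by composing the operations at the vertices of `T` between `e` and the `x i`,
and by plugging the constants of `P` into all the other edges. -/
noncomputable def closedOp (hP : P.IsClosed) (a : Operad.Hom T.operad P) (e : T.Edge) {I : Type}
    [Finite I] (x : I → T.Edge) (hx : Adm x e) : P.Op (fun i => a.col (x i)) (a.col e) :=
  if h : ∃ i, x i = e then
    Operad.unitOn h.choose
      (fun j => (hx.2 _ _ (h.choose_spec.le.trans (hx.1 j))).symm) (congrArg a.col h.choose_spec)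
  else if he : e ∈ T.leaf then
    Operad.const hP ⟨fun i => notMem_leaf_of_lt (Adm_lt hx h i) he⟩ _ _
  else
    P.relabel (branchEquiv x e (Adm_lt hx h)) (P.comp (a.op (vertexOp e he))
        (fun f => closedOp hP a f.1 (fun i : {i // f.1 ≤ x i} => x i.1) (hx.branch f.1)))
      (fun _ => rfl)
termination_by (wellFounded_gt (α := T.Edge)).wrap e
decreasing_by exact f.2.lt


section closedOp

variable (hP : P.IsClosed) (a : Operad.Hom T.operad P)

theorem closedOp_unit {e : T.Edge} {I : Type} [Finite I] {x : I → T.Edge} (hx : Adm x e)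
    (i : I) (hi : ∀ j, j = i) (h : x i = e) :
    closedOp hP a e x hx = Operad.unitOn i hi (congrArg a.col h) := by
  rw [closedOp, dif_pos ⟨i, h⟩]
  have key : ∀ (j : I) (hj : ∀ k, k = j) (h' : x j = e),
      Operad.unitOn (P := P) (c := fun i => a.col (x i)) j hj (congrArg a.col h') =
        Operad.unitOn i hi (congrArg a.col h) := by
    intro j hj h'
    obtain rfl := hi j
    rfl
  exact key _ _ (Exists.choose_spec (p := fun i => x i = e) ⟨i, h⟩)

theorem closedOp_node {e : T.Edge} (he : e ∉ T.leaf) {I : Type} [Finite I] {x : I → T.Edge}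
    (hx : Adm x e) (h : ¬ ∃ i, x i = e) :
    closedOp hP a e x hx = P.relabel (branchEquiv x e (Adm_lt hx h)) (P.comp (a.op (vertexOp e he))
        (fun f => closedOp hP a f.1 (fun i : {i // f.1 ≤ x i} => x i.1) (hx.branch f.1)))
      (fun _ => rfl) := by
  rw [closedOp, dif_neg h, dif_neg he]

theorem closedOp_relabel (e : T.Edge) {I I' : Type} [Finite I] [Finite I'] (σ : I ≃ I')
    {x : I → T.Edge} {x' : I' → T.Edge} (hx : Adm x e) (hx' : Adm x' e)
    (h : ∀ i, x' (σ i) = x i) :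
    P.relabel σ (closedOp hP a e x hx) (fun i => congrArg a.col (h i)) =
      closedOp hP a e x' hx' := by
  induction e using (wellFounded_gt (α := T.Edge)).induction generalizing I I' with
  | _ e ih =>
    by_cases h1 : ∃ i, x i = e
    · obtain ⟨i, hi⟩ := h1
      have hu : ∀ j, j = i := fun j => (hx.2 _ _ (hi.le.trans (hx.1 j))).symm
      rw [closedOp_unit hP a hx i hu hi, closedOp_unit hP a hx' (σ i)
        (fun j => by rw [← hu (σ.symm j), σ.apply_symm_apply]) ((h i).trans hi)]
      exact (P.relabel_trans _ _ _ _ _).trans (Operad.relabel_congr (fun _ => rfl) _ _ _)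
    · have h1' : ¬ ∃ i, x' i = e := fun ⟨i, hi⟩ =>
        h1 ⟨σ.symm i, by rw [← h, σ.apply_symm_apply, hi]⟩
      by_cases he : e ∈ T.leaf
      · exact Operad.const_unique hP ⟨fun i => notMem_leaf_of_lt (Adm_lt hx' h1' i) he⟩ _ _
      · rw [closedOp_node hP a he hx h1, closedOp_node hP a he hx' h1']
        let τ : ∀ f : {f // e ⋖ f}, {i // f.1 ≤ x i} ≃ {i // f.1 ≤ x' i} := fun f =>
          σ.subtypeEquiv (fun i => by rw [h])
        have h2 : (fun f : {f // e ⋖ f} =>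
            closedOp hP a f.1 (fun i : {i // f.1 ≤ x' i} => x' i.1) (hx'.branch f.1)) =
            fun f => P.relabel (τ f) (closedOp hP a f.1 (fun i : {i // f.1 ≤ x i} => x i.1)
              (hx.branch f.1)) (fun i => congrArg a.col (h i.1)) := by
          funext f
          exact (ih f.1 f.2.lt (τ f) (hx.branch f.1) (hx'.branch f.1) (fun i => h i.1)).symm
        have h3 := P.comp_relabel τ (d' := fun f i => a.col (x' i.1))
          (fun f i => congrArg a.col (h i.1)) (a.op (vertexOp e he))
          (fun f => closedOp hP a f.1 (fun i : {i // f.1 ≤ x i} => x i.1) (hx.branch f.1))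
        rw [h2]
        refine (P.relabel_trans (branchEquiv x e (Adm_lt hx h1)) σ (fun _ => rfl) _ _).trans ?_
        refine Eq.trans ?_ (congrArg (fun r => P.relabel (branchEquiv x' e (Adm_lt hx' h1')) r
          (fun _ => rfl)) h3).symm
        refine Eq.trans ?_ (P.relabel_trans (Equiv.sigmaCongrRight τ)
          (branchEquiv x' e (Adm_lt hx' h1')) _ (fun _ => rfl) _).symm
        apply Operad.relabel_congr
        intro s
        rfl

theorem closedOp_graft {e : T.Edge} (he : e ∉ T.leaf) {J : {f // e ⋖ f} → Type}
    [∀ f, Finite (J f)] {y : ∀ f, J f → T.Edge} (hy : ∀ f, Adm (y f) f.1) {I : Type} [Finite I]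
    {x : I → T.Edge} (hx : Adm x e) (ε : (Σ f, J f) ≃ I) (h : ∀ s, x (ε s) = y s.1 s.2) :
    closedOp hP a e x hx = P.relabel ε (P.comp (a.op (vertexOp e he))
        (fun f => closedOp hP a f.1 (y f) (hy f))) (fun s => congrArg a.col (h s)) := by
  have h1 : ∀ s, e < x (ε s) := fun s => by
    rw [h]; exact s.1.2.lt.trans_le ((hy s.1).1 s.2)
  have h1' : ¬ ∃ i, x i = e := by
    rintro ⟨i, hi⟩
    have := h1 (ε.symm i)
    rw [ε.apply_symm_apply, hi] at this
    exact lt_irrefl _ this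
  have hmem : ∀ (f : {f // e ⋖ f}) (s : Σ f, J f), f.1 ≤ x (ε s) → s.1 = f := fun f s hs => by
    rw [h] at hs
    exact Subtype.ext (eq_of_covBy s.1.2 f.2 ((hy s.1).1 s.2) hs)
  let τ : ∀ f : {f // e ⋖ f}, J f ≃ {i // f.1 ≤ x i} := fun f =>
    Equiv.ofBijective (fun j => ⟨ε ⟨f, j⟩, by rw [h]; exact (hy f).1 j⟩) ⟨fun j j' hj => by
      have := ε.injective (congrArg Subtype.val hj)
      simpa using this, by
      rintro ⟨i, hi⟩
      obtain ⟨⟨g, j⟩, rfl⟩ := ε.surjective i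
      obtain rfl : g = f := hmem _ _ hi
      exact ⟨j, rfl⟩⟩
  rw [closedOp_node hP a he hx h1']
  have h2 : (fun f : {f // e ⋖ f} =>
      closedOp hP a f.1 (fun i : {i // f.1 ≤ x i} => x i.1) (hx.branch f.1)) =
      fun f => P.relabel (τ f) (closedOp hP a f.1 (y f) (hy f))
        (fun j => congrArg a.col (h ⟨f, j⟩)) := by
    funext f
    exact (closedOp_relabel hP a f.1 (τ f) (hy f) (hx.branch f.1) (fun j => h ⟨f, j⟩)).symm
  have h3 := P.comp_relabel τ (d' := fun f i => a.col (x i.1))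
    (fun f j => congrArg a.col (h ⟨f, j⟩)) (a.op (vertexOp e he))
    (fun f => closedOp hP a f.1 (y f) (hy f))
  rw [h2]
  refine (congrArg (fun r => P.relabel _ r _) h3).trans ?_
  refine (P.relabel_trans _ _ _ _ _).trans ?_
  apply Operad.relabel_congr
  intro s
  rfl

theorem closedOp_comp (e : T.Edge) {I : Type} [Finite I] {J : I → Type} [∀ i, Finite (J i)]
    {x : I → T.Edge} (hx : Adm x e) {y : ∀ i, J i → T.Edge} (hy : ∀ i, Adm (y i) (x i))
    (hxy : Adm (fun s : Σ i, J i => y s.1 s.2) e) :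
    P.comp (closedOp hP a e x hx) (fun i => closedOp hP a (x i) (y i) (hy i)) =
      closedOp hP a e (fun s : Σ i, J i => y s.1 s.2) hxy := by
  induction e using (wellFounded_gt (α := T.Edge)).induction generalizing I with
  | _ e ih =>
    by_cases h1 : ∃ i, x i = e
    · obtain ⟨i, rfl⟩ := h1
      have hu : ∀ j, j = i := fun j => (hx.2 _ _ (hx.1 j)).symm
      rw [closedOp_unit hP a hx i hu rfl]
      let σ : J i ≃ Σ i, J i := ⟨fun j => ⟨i, j⟩, fun s => (hu s.1) ▸ s.2, fun _ => rfl, by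
        rintro ⟨k, j⟩
        obtain rfl := hu k
        rfl⟩
      refine (Operad.comp_unitOn (c := fun i => a.col (x i)) i hu _ σ (fun _ => rfl)).trans ?_
      exact closedOp_relabel hP a (x i) σ (hy i) hxy (fun _ => rfl)
    · by_cases he : e ∈ T.leaf
      · have hI : IsEmpty I := ⟨fun i => notMem_leaf_of_lt (Adm_lt hx h1 i) he⟩
        exact Operad.const_unique hP inferInstance _ _
      · have hlt := Adm_lt hx h1
        rw [closedOp_node hP a he hx h1]
        refine (P.relabel_comp (branchEquiv x e hlt) (c := fun i => a.col (x i)) _ _).trans ?_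
        refine (congrArg (fun p => P.relabel _ p _) (Operad.relabel_symm (P.comp_assoc
          (a.op (vertexOp e he))
          (fun f => closedOp hP a f.1 (fun i : {i // f.1 ≤ x i} => x i.1) (hx.branch f.1))
          (fun f i => closedOp hP a (x i.1) (y i.1) (hy i.1))))).trans ?_
        refine (P.relabel_trans _ _ _ _ _).trans ?_
        have h2 : ∀ f : {f // e ⋖ f}, Adm (fun s : Σ i : {i // f.1 ≤ x i}, J i.1 => y s.1.1 s.2) f.1 :=
          fun f => (hx.branch f.1).of_comp T.total_below (fun i => hy i.1)
        have h3 := fun f : {f // e ⋖ f} => ih f.1 f.2.lt (hx.branch f.1) (fun i => hy i.1) (h2 f)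
        refine (congrArg (fun q => P.relabel _ (P.comp (a.op (vertexOp e he)) q) _)
          (funext h3)).trans ?_
        exact (closedOp_graft hP a he h2 hxy _ (fun _ => rfl)).symm

theorem closedOp_eq (e : T.Edge) {I : Type} [Finite I] {x : I → T.Edge} (hx : Adm x e)
    (p : T.operad.Op x e) : closedOp hP a e x hx = a.op p := by
  obtain ⟨hi, hA⟩ := p.down
  generalize hA' : Set.range x = A at hA
  induction hA generalizing I with
  | edge e =>
    obtain ⟨i, h⟩ : e ∈ Set.range x := by rw [hA']; rfl
    subst h
    have hu : ∀ j, j = i := fun j => (hx.2 _ _ (hx.1 j)).symm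
    rw [closedOp_unit hP a hx i hu rfl, Operad.unitOn, ← a.op_one]
    exact (a.op_relabel (c := fun _ : Unit => x i) (d := x)
      ⟨fun _ : Unit => i, fun _ => (), fun _ => rfl, fun j => (hu j).symm⟩ (fun _ => rfl) _).symm
  | graft e he A hA ih =>
    let y : ∀ f : {f // e ⋖ f}, {i // x i ∈ A f} → T.Edge := fun f i => x i.1
    have hy : ∀ f, Adm (y f) f.1 := fun f =>
      ⟨fun i => (hA f).le _ i.2, fun i j hij => Subtype.ext (hx.2 _ _ hij)⟩
    have hyA : ∀ f, Set.range (y f) = A f := fun f => by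
      ext g
      constructor
      · rintro ⟨i, rfl⟩; exact i.2
      · intro hg
        obtain ⟨i, rfl⟩ : g ∈ Set.range x := by rw [hA']; exact Set.mem_iUnion.2 ⟨f, hg⟩
        exact ⟨⟨i, hg⟩, rfl⟩
    have hyi : ∀ f, Function.Injective (y f) := fun f i j hij => Subtype.ext (hi hij)
    let ε : (Σ f : {f // e ⋖ f}, {i // x i ∈ A f}) ≃ I := Equiv.ofBijective (fun s => s.2.1) ⟨by
      rintro ⟨f, i, hif⟩ ⟨g, j, hjg⟩ h
      obtain rfl : i = j := h
      obtain rfl : f = g :=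
        Subtype.ext (eq_of_covBy f.2 g.2 ((hA f).le _ hif) ((hA g).le _ hjg))
      rfl, fun i => by
      have : x i ∈ ⋃ f, A f := by rw [← hA']; exact ⟨i, rfl⟩
      obtain ⟨f, hf⟩ := Set.mem_iUnion.1 this
      exact ⟨⟨f, i, hf⟩, rfl⟩⟩
    rw [closedOp_graft hP a he hy hx ε (fun _ => rfl)]
    let q : ∀ f : {f // e ⋖ f}, T.operad.Op (y f) f.1 := fun f =>
      ⟨hyi f, by rw [hyA f]; exact hA f⟩
    have h1 : (fun f : {f // e ⋖ f} => closedOp hP a f.1 (y f) (hy f)) = fun f => a.op (q f) :=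
      funext fun f => ih f (hy f) (q f) (hyi f) (hyA f)
    rw [h1]
    refine (congrArg (fun r => P.relabel ε r _) (a.op_comp (vertexOp e he) q).symm).trans ?_
    exact (a.op_relabel (c := fun s : Σ f : {f // e ⋖ f}, {i // x i ∈ A f} => x s.2.1) (d := x)
      ε (fun _ => rfl) _).symm

theorem _root_.Adm.map (b : Operad.Hom S.operad T.operad) {e : S.Edge} {I : Type}
    {x : I → S.Edge} (hx : Adm x e) : Adm (fun i => edgeMap b (x i)) (edgeMap b e) :=
  ⟨fun i => hom_mono b (hx.1 i), fun i j hij => (hom_reflects b hij).elim (hx.2 i j)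
    (fun h => (hx.2 j i h).symm)⟩

theorem closedOp_map (b : Operad.Hom S.operad T.operad) (e : S.Edge) {I : Type} [Finite I]
    {x : I → S.Edge} (hx : Adm x e) :
    closedOp hP (a.comp b) e x hx =
      closedOp hP a (edgeMap b e) (fun i => edgeMap b (x i)) (hx.map b) := by
  induction e using (wellFounded_gt (α := S.Edge)).induction generalizing I with
  | _ e ih =>
    by_cases h1 : ∃ i, x i = e
    · obtain ⟨i, rfl⟩ := h1
      have hu : ∀ j, j = i := fun j => (hx.2 _ _ (hx.1 j)).symm
      rw [closedOp_unit hP _ hx i hu rfl, closedOp_unit hP a (hx.map b) i hu rfl]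
      rfl
    · by_cases he : e ∈ S.leaf
      · exact Operad.const_unique hP ⟨fun i => notMem_leaf_of_lt (Adm_lt hx h1 i) he⟩ _ _
      · rw [closedOp_node hP _ he hx h1]
        have h2 := fun f : {f // e ⋖ f} => ih f.1 f.2.lt (hx.branch f.1)
        refine (congrArg (fun q => P.relabel _ (P.comp ((a.comp b).op (vertexOp e he)) q) _)
          (funext h2)).trans ?_
        have hv : Adm (fun f : {f // e ⋖ f} => f.1) e :=
          ⟨fun f => f.2.le, fun f g h => Subtype.ext (eq_of_covBy f.2 g.2 h le_rfl)⟩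
        have h3 : (a.comp b).op (vertexOp e he) =
            closedOp hP a (edgeMap b e) (fun f : {f // e ⋖ f} => edgeMap b f.1) (hv.map b) :=
          (closedOp_eq hP a _ (hv.map b) (b.op (vertexOp e he))).symm
        rw [h3]
        have h4 : ∀ f : {f // e ⋖ f}, Adm (fun i : {i // f.1 ≤ x i} => edgeMap b (x i.1))
          (edgeMap b f.1) := fun f => (hx.branch f.1).map b
        have h5 := (hv.map b).of_comp T.total_below h4
        refine (congrArg (fun r => P.relabel _ r _)
          (closedOp_comp hP a (edgeMap b e) (hv.map b) h4 h5)).trans ?_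
        exact closedOp_relabel hP a _ _ h5 (hx.map b) (fun _ => rfl)

end closedOp

end OperadicTree

/-- A forest: a finite family of trees. -/
structure Forest : Type 1 where
  Idx : Type
  [finite : Finite Idx]
  tree : Idx → OperadicTree

attribute [instance] Forest.finite

namespace Forest

/-- The set of edges of a forest. It carries the disjoint union order: edges of different
components are not comparable. -/
abbrev Edge (F : Forest) : Type := Σ i, (F.tree i).Edge

/-- The root edge of the component `i`. -/
abbrev root (F : Forest) (i : F.Idx) : F.Edge := ⟨i, (F.tree i).root⟩

theorem edge_le_iff {F : Forest} {i : F.Idx} {e f : (F.tree i).Edge} :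
    (⟨i, e⟩ : F.Edge) ≤ ⟨i, f⟩ ↔ e ≤ f :=
  Sigma.mk_le_mk_iff (α := fun i => (F.tree i).Edge)

/-- A morphism of forests: a map of index sets and morphisms of trees
`tree i ⟶ tree (idx i)`, such that distinct components that are sent to the same component
have independent images (edges of the one are not comparable with edges of the other). -/
@[ext]
structure Hom (F G : Forest) where
  idx : F.Idx → G.Idx
  map : ∀ i, F.tree i ⟶ G.tree (idx i)
  indep : ∀ i i', i ≠ i' → ∀ (e : (F.tree i).Edge) (e' : (F.tree i').Edge),
    ¬ ((⟨idx i, OperadicTree.edgeMap (map i) e⟩ : G.Edge) ≤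
      ⟨idx i', OperadicTree.edgeMap (map i') e'⟩)

/-- The map on edges underlying a morphism of forests. -/
def Hom.edge {F G : Forest} (φ : Hom F G) (e : F.Edge) : G.Edge :=
  ⟨φ.idx e.1, OperadicTree.edgeMap (φ.map e.1) e.2⟩

theorem Hom.edge_mono {F G : Forest} (φ : Hom F G) {e f : F.Edge} (h : e ≤ f) :
    φ.edge e ≤ φ.edge f := by
  obtain ⟨i, e, f, h⟩ := h
  exact Sigma.LE.fiber _ _ _ (OperadicTree.hom_mono _ h)

theorem Hom.edge_reflects {F G : Forest} (φ : Hom F G) {e f : F.Edge}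
    (h : φ.edge e ≤ φ.edge f) : e ≤ f ∨ f ≤ e := by
  obtain ⟨i, e⟩ := e
  obtain ⟨j, f⟩ := f
  by_cases hij : i = j
  · subst hij
    have h' : OperadicTree.edgeMap (φ.map i) e ≤ OperadicTree.edgeMap (φ.map i) f :=
      edge_le_iff.1 h
    exact (OperadicTree.hom_reflects _ h').imp (Sigma.LE.fiber _ _ _) (Sigma.LE.fiber _ _ _)
  · exact absurd h (φ.indep i j hij e f)

/-- The category of forests. -/
instance : Category Forest where
  Hom F G := Hom F G
  id F :=
    { idx := fun i => i
      map := fun i => 𝟙 (F.tree i)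
      indep := fun i i' hi e e' h => by
        obtain ⟨h, _⟩ := Sigma.le_def.1 h
        exact hi h }
  comp {F G H} φ ψ :=
    { idx := fun i => ψ.idx (φ.idx i)
      map := fun i => φ.map i ≫ ψ.map (φ.idx i)
      indep := fun i i' hi e e' h => by
        have h' : ψ.edge (φ.edge ⟨i, e⟩) ≤ ψ.edge (φ.edge ⟨i', e'⟩) := h
        rcases ψ.edge_reflects h' with h' | h'
        · exact φ.indep i i' hi e e' h'
        · exact φ.indep i' i hi.symm e' e h' }

variable {F G : Forest} {P : Operad.{u}}

theorem total_below (e f g : F.Edge) (h : e ≤ g) (h' : f ≤ g) : e ≤ f ∨ f ≤ e := by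
  obtain ⟨i, e, g, h⟩ := h
  obtain ⟨_, f, _, h'⟩ := h'
  exact ((F.tree i).total_below e f g h h').imp (Sigma.LE.fiber _ _ _) (Sigma.LE.fiber _ _ _)

end Forest

theorem Adm.forestMap {F G : Forest} (φ : F ⟶ G) {I : Type} {x : I → F.Edge} {e : F.Edge}
    (hx : Adm x e) : Adm (fun i => Forest.Hom.edge φ (x i)) (Forest.Hom.edge φ e) :=
  ⟨fun i => Forest.Hom.edge_mono φ (hx.1 i), fun i j hij =>
    (Forest.Hom.edge_reflects φ hij).elim (hx.2 i j) (fun h => (hx.2 j i h).symm)⟩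

/-- The forest nerve of `P`: its value at the forest `⨁ᵢ Tᵢ` is the product over `i` of the sets
of operad maps `Ω(Tᵢ) → P`. -/
def forestNerve (P : Operad.{u}) : Forestᵒᵖ ⥤ Type (max 1 u) where
  obj F := ∀ i : F.unop.Idx, Operad.Hom (F.unop.tree i).operad P
  map φ := ↾ fun a i => (a (φ.unop.idx i)).comp (φ.unop.map i)

namespace Forest

variable {F G : Forest} {P : Operad.{u}}

/-- The colour of an edge in a `P`-decorated forest. -/
abbrev colour (a : ∀ i, Operad.Hom (F.tree i).operad P) (e : F.Edge) : P.Col := (a e.1).col e.2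

theorem Adm_eq {I : Type} {x : I → F.Edge} {e : F.Edge} (hx : Adm x e) :
    ∃ y : I → (F.tree e.1).Edge, x = fun i => ⟨e.1, y i⟩ := by
  have h : ∀ i, ∃ y : (F.tree e.1).Edge, x i = ⟨e.1, y⟩ := fun i => by
    have h := hx.1 i
    generalize x i = z at h
    obtain ⟨j, e, z, h⟩ := h
    exact ⟨z, rfl⟩
  choose y hy using h
  exact ⟨y, funext hy⟩

theorem Adm_fiber {I : Type} {j : F.Idx} {y : I → (F.tree j).Edge} {e : (F.tree j).Edge}
    (hx : Adm (fun i => (⟨j, y i⟩ : F.Edge)) ⟨j, e⟩) : Adm y e :=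
  ⟨fun i => edge_le_iff.1 (hx.1 i), fun i i' h => hx.2 i i' (edge_le_iff.2 h)⟩

section forestOp

variable (hP : P.IsClosed) (a : ∀ i, Operad.Hom (F.tree i).operad P)

/-- The operations `OperadicTree.closedOp` for the edges of a `P`-decorated forest. -/
noncomputable def forestOp {I : Type} [Finite I] (x : I → F.Edge) (e : F.Edge) (hx : Adm x e) :
    P.Op (fun i => colour a (x i)) (colour a e) :=
  P.relabel (Equiv.refl I)
    (OperadicTree.closedOp hP (a e.1) e.2 (Adm_eq hx).choose
      (Adm_fiber (F := F) (j := e.1) (by rw [← (Adm_eq hx).choose_spec]; exact hx)))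
    (fun i => congrArg (colour a) (congrFun (Adm_eq hx).choose_spec i))

theorem forestOp_fiber {I : Type} [Finite I] {j : F.Idx} {y : I → (F.tree j).Edge}
    {e : (F.tree j).Edge} (hx : Adm (fun i => (⟨j, y i⟩ : F.Edge)) ⟨j, e⟩) (hy : Adm y e) :
    forestOp hP a (fun i => (⟨j, y i⟩ : F.Edge)) ⟨j, e⟩ hx =
      OperadicTree.closedOp hP (a j) e y hy :=
  OperadicTree.closedOp_relabel hP (a j) e (Equiv.refl I) _ hy (fun i => by
    have := congrFun (Adm_eq hx).choose_spec i
    simpa using this)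

theorem forestOp_unit {I : Type} [Finite I] {x : I → F.Edge} {e : F.Edge} (hx : Adm x e) (i : I)
    (hi : ∀ j, j = i) (h : x i = e) :
    forestOp hP a x e hx = Operad.unitOn i hi (congrArg (colour a) h) := by
  obtain ⟨y, rfl⟩ := Adm_eq hx
  obtain ⟨j, e⟩ := e
  rw [forestOp_fiber hP a hx (Adm_fiber hx),
    OperadicTree.closedOp_unit hP (a j) (Adm_fiber hx) i hi (by simpa using h)]

theorem forestOp_relabel {I I' : Type} [Finite I] [Finite I'] (σ : I ≃ I') {x : I → F.Edge}
    {x' : I' → F.Edge} {e : F.Edge} (hx : Adm x e) (hx' : Adm x' e) (h : ∀ i, x' (σ i) = x i) :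
    P.relabel σ (forestOp hP a x e hx) (fun i => congrArg (colour a) (h i)) =
      forestOp hP a x' e hx' := by
  obtain ⟨y, rfl⟩ := Adm_eq hx
  obtain ⟨y', rfl⟩ := Adm_eq hx'
  obtain ⟨j, e⟩ := e
  rw [forestOp_fiber hP a hx (Adm_fiber hx), forestOp_fiber hP a hx' (Adm_fiber hx')]
  exact OperadicTree.closedOp_relabel hP (a j) e σ _ _ (fun i => by simpa using h i)

theorem forestOp_comp {I : Type} [Finite I] {J : I → Type} [∀ i, Finite (J i)]
    {x : I → F.Edge} {e : F.Edge} (hx : Adm x e) {y : ∀ i, J i → F.Edge}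
    (hy : ∀ i, Adm (y i) (x i)) (hxy : Adm (fun s : Σ i, J i => y s.1 s.2) e) :
    P.comp (forestOp hP a x e hx) (fun i => forestOp hP a (y i) (x i) (hy i)) =
      forestOp hP a (fun s : Σ i, J i => y s.1 s.2) e hxy := by
  obtain ⟨j, e⟩ := e
  obtain ⟨x, rfl⟩ := Adm_eq hx
  choose z hz using fun i => Adm_eq (hy i)
  obtain rfl : y = fun i k => ⟨j, z i k⟩ := funext hz
  have h1 : ∀ i, forestOp hP a (fun k => (⟨j, z i k⟩ : F.Edge)) ⟨j, x i⟩ (hy i) =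
      OperadicTree.closedOp hP (a j) (x i) (z i) (Adm_fiber (hy i)) := fun i =>
    forestOp_fiber hP a (hy i) _
  rw [forestOp_fiber hP a hx (Adm_fiber hx), forestOp_fiber hP a hxy (Adm_fiber hxy)]
  refine (congrArg (fun q => P.comp _ q) (funext h1)).trans ?_
  exact OperadicTree.closedOp_comp hP (a j) e _ _ _

theorem forestOp_map {G : Forest} (φ : G ⟶ F) {I : Type} [Finite I] {x : I → G.Edge}
    {e : G.Edge} (hx : Adm x e) :
    forestOp (F := G) hP (fun i => (a (Hom.idx φ i)).comp (Hom.map φ i)) x e hx =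
      forestOp hP a (fun i => Hom.edge φ (x i)) (Hom.edge φ e) (hx.forestMap φ) := by
  obtain ⟨j, e⟩ := e
  obtain ⟨x, rfl⟩ := Adm_eq hx
  rw [forestOp_fiber hP _ hx (Adm_fiber hx)]
  refine (OperadicTree.closedOp_map hP (a (Hom.idx φ j)) (Hom.map φ j) e _).trans ?_
  exact (forestOp_fiber hP a (hx.forestMap φ) _).symm

end forestOp

end Forest

namespace RightModule

variable {P : Operad.{u}} (hP : P.IsClosed) (M : RightModule.{u, max 1 u} P)

theorem relabel_congr {I J : Type} [Finite I] [Finite J] {σ τ : I ≃ J} (h : ∀ i, σ i = τ i)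
    {c : I → P.Col} {d : J → P.Col} (m : M.obj c) (hσ : ∀ i, d (σ i) = c i)
    (hτ : ∀ i, d (τ i) = c i) : M.relabel σ m hσ = M.relabel τ m hτ := by
  obtain rfl : σ = τ := Equiv.ext h
  rfl

theorem relabel_id {I : Type} [Finite I] {σ : I ≃ I} (h : ∀ i, σ i = i)
    {c : I → P.Col} (m : M.obj c) (hσ : ∀ i, c (σ i) = c i) : M.relabel σ m hσ = m :=
  (M.relabel_congr h m _ _).trans (M.relabel_refl m)

theorem relabel_symm {I J : Type} [Finite I] [Finite J] {σ : I ≃ J}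
    {c : I → P.Col} {d : J → P.Col} {m : M.obj c} {n : M.obj d}
    {hσ : ∀ i, d (σ i) = c i} (h : M.relabel σ m hσ = n) :
    m = M.relabel σ.symm n (fun j => by rw [← hσ, σ.apply_symm_apply]) := by
  subst h
  rw [M.relabel_trans]
  exact (M.relabel_id (by simp) _ _).symm

theorem Adm_root {F G : Forest} (φ : F ⟶ G) (j : G.Idx) :
    Adm (fun i : {i // Forest.Hom.idx φ i = j} => Forest.Hom.edge φ (F.root i.1)) (G.root j) := by
  constructor
  · rintro ⟨i, rfl⟩
    exact Forest.edge_le_iff.2 ((G.tree _).root_le _)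
  · rintro ⟨i, hi⟩ ⟨i', hi'⟩ h
    by_contra hne
    exact Forest.Hom.indep φ i i' (fun h' => hne (Subtype.ext h')) _ _ h

/-- The action of a morphism of forests `φ : F ⟶ G` on an element `m` of `M` at the root colours of
a `P`-decoration `a` of `G`: for each root of `G`, act on `m` by the operation of `P` determined
by `a` whose inputs are the images of the roots of `F` in the component of that root. -/
noncomputable def pull {F G : Forest} (φ : F ⟶ G) (a : ∀ i, Operad.Hom (G.tree i).operad P)
    (m : M.obj (fun j => Forest.colour a (G.root j))) :
    M.obj (fun i => Forest.colour a (Forest.Hom.edge φ (F.root i))) :=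
  M.relabel (Equiv.sigmaFiberEquiv (Forest.Hom.idx φ))
    (M.act m (fun j => Forest.forestOp hP a _ (G.root j) (Adm_root φ j))) (fun _ => rfl)

theorem pull_id {F : Forest} (a : ∀ i, Operad.Hom (F.tree i).operad P)
    (m : M.obj (fun j => Forest.colour a (F.root j))) : M.pull hP (𝟙 F) a m = m := by
  unfold pull
  have h : ∀ j, Forest.forestOp hP a _ (F.root j) (Adm_root (𝟙 F) j) =
    P.relabel ⟨fun _ : Unit => (⟨j, rfl⟩ : {i // Forest.Hom.idx (𝟙 F) i = j}), fun _ => (),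
      fun _ => rfl, fun i => Subtype.ext i.2.symm⟩ (P.one _) (fun _ => rfl) := fun j =>
    Forest.forestOp_unit hP a (Adm_root (𝟙 F) j) ⟨j, rfl⟩ (fun i => Subtype.ext i.2) rfl
  refine (congrArg (fun q => M.relabel (Equiv.sigmaFiberEquiv (Forest.Hom.idx (𝟙 F)))
    (M.act m q) (fun _ => rfl)) (funext h)).trans ?_
  refine (congrArg (fun q => M.relabel (Equiv.sigmaFiberEquiv (Forest.Hom.idx (𝟙 F)))
    q (fun _ => rfl)) (M.act_relabel _ _ m _)).trans ?_
  refine (M.relabel_trans _ _ _ _ _).trans ?_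
  refine Eq.trans ?_ (M.act_one m)
  apply M.relabel_congr
  intro s
  rfl

theorem pull_comp {F G H : Forest} (φ : F ⟶ G) (ψ : G ⟶ H)
    (a : ∀ i, Operad.Hom (H.tree i).operad P) (m : M.obj (fun j => Forest.colour a (H.root j))) :
    M.pull hP (φ ≫ ψ) a m =
      M.pull hP φ (fun i => (a (Forest.Hom.idx ψ i)).comp (Forest.Hom.map ψ i))
        (M.pull hP ψ a m) := by
  symm
  unfold pull
  refine (congrArg (fun q => M.relabel (Equiv.sigmaFiberEquiv (Forest.Hom.idx φ)) q
    (fun _ => rfl)) (M.relabel_act (Equiv.sigmaFiberEquiv (Forest.Hom.idx ψ))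
      (c := fun i => Forest.colour a (Forest.Hom.edge ψ (G.root i))) _ _)).trans ?_
  refine (M.relabel_trans _ _ _ _ _).trans ?_
  let q := fun j : H.Idx => Forest.forestOp hP a _ (H.root j) (Adm_root ψ j)
  let x : ∀ (j : H.Idx) (i : {i // Forest.Hom.idx ψ i = j}),
      {l // Forest.Hom.idx φ l = i.1} → H.Edge := fun j i l =>
    Forest.Hom.edge ψ (Forest.Hom.edge φ (F.root l.1))
  have hx : ∀ (j : H.Idx) (i : {i // Forest.Hom.idx ψ i = j}),
      Adm (x j i) (Forest.Hom.edge ψ (G.root i.1)) := fun j i => (Adm_root φ i.1).forestMap ψ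
  let r := fun (j : H.Idx) (i : {i // Forest.Hom.idx ψ i = j}) =>
    Forest.forestOp hP a (x j i) (Forest.Hom.edge ψ (G.root i.1)) (hx j i)
  have h1 : ∀ s : Σ j : H.Idx, {i // Forest.Hom.idx ψ i = j},
      Forest.forestOp hP (fun i => (a (Forest.Hom.idx ψ i)).comp (Forest.Hom.map ψ i)) _
        (G.root s.2.1) (Adm_root φ s.2.1) = r s.1 s.2 := fun s =>
    Forest.forestOp_map hP a ψ (Adm_root φ s.2.1)
  refine (congrArg (fun q' => M.relabel _ (M.act (M.act m q) q') _) (funext h1)).trans ?_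
  refine (congrArg (fun n => M.relabel _ n _) (M.relabel_symm (M.act_act m q r))).trans ?_
  refine (M.relabel_trans _ _ _ _ _).trans ?_
  have hxy : ∀ j, Adm (fun s : Σ i : {i // Forest.Hom.idx ψ i = j}, {l // Forest.Hom.idx φ l = i.1} =>
      x j s.1 s.2) (H.root j) := fun j => (Adm_root ψ j).of_comp Forest.total_below (hx j)
  let τ : ∀ j, (Σ i : {i // Forest.Hom.idx ψ i = j}, {l // Forest.Hom.idx φ l = i.1}) ≃
      {l // Forest.Hom.idx (φ ≫ ψ) l = j} := fun j =>
    { toFun := fun s => ⟨s.2.1, (congrArg (Forest.Hom.idx ψ) s.2.2).trans s.1.2⟩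
      invFun := fun l => ⟨⟨Forest.Hom.idx φ l.1, l.2⟩, l.1, rfl⟩
      left_inv := by
        rintro ⟨⟨i, hi⟩, l, hl⟩
        dsimp only at hl
        subst hl
        rfl
      right_inv := fun l => rfl }
  have h2 : ∀ j, P.comp (q j) (r j) = Forest.forestOp hP a _ (H.root j) (hxy j) := fun j =>
    Forest.forestOp_comp hP a (Adm_root ψ j) (hx j) (hxy j)
  have h3 : ∀ j, Forest.forestOp hP a _ (H.root j) (Adm_root (φ ≫ ψ) j) =
      P.relabel (τ j) (Forest.forestOp hP a _ (H.root j) (hxy j)) (fun _ => rfl) := fun j =>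
    (Forest.forestOp_relabel hP a (τ j) (hxy j) (Adm_root (φ ≫ ψ) j) (fun _ => rfl)).symm
  refine (congrArg (fun q' => M.relabel _ (M.act m q') _) (funext h2)).trans ?_
  symm
  refine (congrArg (fun q' => M.relabel (Equiv.sigmaFiberEquiv (Forest.Hom.idx (φ ≫ ψ)))
    (M.act m q') (fun _ => rfl)) (funext h3)).trans ?_
  refine (congrArg (fun n => M.relabel (Equiv.sigmaFiberEquiv (Forest.Hom.idx (φ ≫ ψ)))
    n (fun _ => rfl)) (M.act_relabel τ (d' := fun j l => Forest.colour a
      (Forest.Hom.edge (φ ≫ ψ) (F.root l.1))) (fun _ _ => rfl) m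
      (fun j => Forest.forestOp hP a _ (H.root j) (hxy j)))).trans ?_
  refine (M.relabel_trans _ _ _ _ _).trans ?_
  apply M.relabel_congr
  rintro ⟨j, ⟨i, hi⟩, l, hl⟩
  rfl

theorem pull_app {M N : RightModule.{u, max 1 u} P} (f : Hom M N) {F G : Forest} (φ : F ⟶ G)
    (a : ∀ i, Operad.Hom (G.tree i).operad P) (m : M.obj (fun j => Forest.colour a (G.root j))) :
    f.app _ (M.pull hP φ a m) = N.pull hP φ a (f.app _ m) := by
  unfold pull
  refine (f.app_relabel _ _ _).trans ?_
  exact congrArg (fun n => N.relabel (Equiv.sigmaFiberEquiv (Forest.Hom.idx φ)) n (fun _ => rfl))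
    (f.app_act m (fun j => Forest.forestOp hP a _ (G.root j) (Adm_root φ j)))

end RightModule

/-- The functor `N_P`. For a closed operad `P` and a right `P`-module `M`, the value of `N_P M` at a
forest `F` is the set of pairs of `a ∈ (N P)_F` and an element of `M` at the family of colours of
the roots of `F` in `a`, and `N_P M` lies over `N P` by the projection to `a`. -/
noncomputable def moduleNerve {P : Operad.{u}} (hP : P.IsClosed) :
    RightModule.{u, max 1 u} P ⥤ Over (forestNerve P) where
  obj M := Over.mk (Y :=
    { obj := fun F => Σ a : (forestNerve P).obj F, M.obj (fun i => Forest.colour a (F.unop.root i))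
      map := fun φ => ↾ fun s => ⟨(forestNerve P).map φ s.1, M.pull hP φ.unop s.1 s.2⟩
      map_id := fun F => by
        apply ConcreteCategory.hom_ext
        rintro ⟨a, m⟩
        exact congrArg (fun n => (⟨a, n⟩ : Σ a : (forestNerve P).obj F,
          M.obj (fun i => Forest.colour a (F.unop.root i)))) (M.pull_id hP a m)
      map_comp := fun φ ψ => by
        apply ConcreteCategory.hom_ext
        rintro ⟨a, m⟩
        exact congrArg (fun n => (⟨(forestNerve P).map (φ ≫ ψ) a, n⟩ : Σ a : (forestNerve P).obj _,
          M.obj (fun i => Forest.colour a (Forest.root _ i)))) (M.pull_comp hP ψ.unop φ.unop a m) })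
    { app := fun F => ↾ fun s => s.1 }
  map {M N} f := Over.homMk
    { app := fun F => ↾ fun s => ⟨s.1, f.app _ s.2⟩
      naturality := fun F G φ => by
        apply ConcreteCategory.hom_ext
        rintro ⟨a, m⟩
        exact congrArg (fun n => (⟨(forestNerve P).map φ a, n⟩ : Σ a : (forestNerve P).obj _,
          N.obj (fun i => Forest.colour a (Forest.root _ i))))
          (RightModule.pull_app hP f φ.unop a m) }

/-- The tree `η` with a single edge, which is both its root and a leaf. -/
@[reducible] def OperadicTree.eta : OperadicTree where
  Edge := Unit
  root := ()
  root_le _ := le_rfl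
  total_below _ _ _ _ _ := Or.inl le_rfl
  leaf := Set.univ
  leaf_isMax _ _ := fun _ _ => le_rfl

namespace OperadicTree

theorem eta_op_unique {I : Type} {x : I → eta.Edge} {e : eta.Edge} [Finite I]
    (p : eta.operad.Op x e) : ∃ i : I, ∀ j, j = i := by
  obtain ⟨hi, hA⟩ := p.down
  generalize hA' : Set.range x = A at hA
  cases hA with
  | edge =>
    obtain ⟨i, -⟩ : e ∈ Set.range x := by rw [hA']; rfl
    exact ⟨i, fun j => hi rfl⟩
  | graft _ he => exact absurd (Set.mem_univ _) he

variable {P : Operad.{u}}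

theorem _root_.Operad.unitOn_relabel {I J : Type} [Finite I] [Finite J] (σ : I ≃ J) (i : I)
    (hi : ∀ j, j = i) (k : J) (hk : ∀ j, j = k) {c : I → P.Col} {d : J → P.Col} {e : P.Col}
    (hc : c i = e) (hd : d k = e) (h : ∀ i, d (σ i) = c i) :
    P.relabel σ (Operad.unitOn i hi hc) h = Operad.unitOn k hk hd := by
  unfold Operad.unitOn
  rw [P.relabel_trans]
  exact Operad.relabel_congr (fun _ => hk _) _ _ _

theorem _root_.Operad.unitOn_unit (c : P.Col) :
    Operad.unitOn (P := P) () (fun _ => rfl) (c := fun _ => c) rfl = P.one c :=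
  Operad.relabel_id (fun _ => rfl) _ _

/-- The operad map `Ω(η) → P` given by a colour of `P`. -/
noncomputable def etaHom (c : P.Col) : Operad.Hom eta.operad P where
  col _ := c
  op p := Operad.unitOn (eta_op_unique p).choose (eta_op_unique p).choose_spec rfl
  op_relabel σ _ _ _ h p := (Operad.unitOn_relabel σ _ _ _ _ _ _ _).symm
  op_one _ := Operad.unitOn_unit c
  op_comp {I J _ _ _ _ _} p q := by
    obtain ⟨i, hi⟩ := eta_op_unique p
    let σ : J i ≃ Σ i, J i := ⟨fun j => ⟨i, j⟩, fun s => (hi s.1) ▸ s.2, fun _ => rfl, by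
      rintro ⟨k, j⟩
      obtain rfl := hi k
      rfl⟩
    have h : (eta_op_unique p).choose = i := hi _
    have h1 := Operad.comp_unitOn (P := P) i hi (c := fun _ => c) (d := fun _ _ => c)
      (fun i => Operad.unitOn (eta_op_unique (q i)).choose (eta_op_unique (q i)).choose_spec rfl)
      σ (fun _ => rfl)
    have h2 : Operad.unitOn (P := P) (eta_op_unique p).choose (eta_op_unique p).choose_spec
      (c := fun _ => c) rfl = Operad.unitOn i hi rfl := by congr
    refine Eq.symm ((congrArg (fun r => P.comp r _) h2).trans (h1.trans ?_))
    exact Operad.unitOn_relabel σ _ _ _ _ _ _ _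

end OperadicTree

namespace Forest

variable {P : Operad.{u}}

/-- The forest `ρ(F)` of roots of `F`. -/
def roots (F : Forest) : Forest where
  Idx := F.Idx
  tree _ := OperadicTree.eta

/-- The inclusion `ρ(F) ⟶ F`. -/
noncomputable def rootsInclusion (F : Forest) : F.roots ⟶ F where
  idx i := i
  map i := OperadicTree.etaHom (P := (F.tree i).operad) (F.tree i).root
  indep i i' hi e e' h := by
    obtain ⟨h, _⟩ := Sigma.le_def.1 h
    exact hi h

end Forest

namespace RightModule

variable {P : Operad.{u}}

/-- The set `M(k) = ∐ M(c₁, …, c_k)`, for a finite index set `I` in place of `{1, …, k}`. -/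
def total (M : RightModule.{u, w} P) (I : Type) [Finite I] : Type (max u w) :=
  Σ c : I → P.Col, M.obj c

/-- The map `M(ρ(F)) → (N P)_{ρ(F)}` that sends an element of `M(c)` to the family of colours `c`. -/
noncomputable def totalToNerve (M : RightModule.{u, max 1 u} P) (F : Forest) :
    M.total F.Idx → (forestNerve P).obj (Opposite.op F.roots) :=
  fun s i => OperadicTree.etaHom (s.1 i)

/-- The map `(N_P M)_F → M(ρ(F))`. -/
noncomputable def nerveToTotal {P : Operad.{u}} (hP : P.IsClosed) (M : RightModule.{u, max 1 u} P)
    (F : Forest) : ((moduleNerve hP).obj M).left.obj (Opposite.op F) → M.total F.Idx :=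
  fun s => ⟨fun i => Forest.colour s.1 (F.root i), s.2⟩

/-- Elements of the free right module on a generator with colours `c`: a map `f` of index sets
together with an operation of `P` with output `c i` for every `i`, whose inputs are indexed by
the fibre of `f` over `i`. -/
structure FreeElt {I J : Type} [Finite I] [Finite J] (c : I → P.Col) (d : J → P.Col) :
    Type (max 1 u) where
  idx : J → I
  op : ∀ i, P.Op (fun j : {j // idx j = i} => d j.1) (c i)

theorem FreeElt.eq_of {I J : Type} [Finite I] [Finite J] {c : I → P.Col} {d : J → P.Col}
    {m n : FreeElt c d} (h : ∀ j, m.idx j = n.idx j)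
    (h' : ∀ i, P.relabel (Equiv.subtypeEquivRight (fun j => by rw [h j])) (m.op i)
      (fun _ => rfl) = n.op i) : m = n := by
  obtain ⟨f, p⟩ := m
  obtain ⟨g, q⟩ := n
  obtain rfl : f = g := funext h
  obtain rfl : p = q := funext fun i => by
    refine Eq.trans ?_ (h' i)
    exact (Operad.relabel_id (fun _ => rfl) _ _).symm
  rfl

/-- The free right `P`-module on a generator with finite family of colours `c`. -/
def free {I : Type} [Finite I] (c : I → P.Col) : RightModule.{u, max 1 u} P where
  obj d := FreeElt c d
  relabel σ _ _ m h :=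
    { idx := fun j => m.idx (σ.symm j)
      op := fun i => P.relabel (σ.subtypeEquiv (p := fun j => m.idx j = i)
        (q := fun j => m.idx (σ.symm j) = i) (fun j => by rw [σ.symm_apply_apply]))
        (m.op i) (fun j => h j.1) }
  act {J K _ _ _ _} m q :=
    { idx := fun s => m.idx s.1
      op := fun i => P.relabel (J := {s : Σ j, K j // m.idx s.1 = i})
        ⟨fun s : Σ j : {j // m.idx j = i}, K j.1 => ⟨⟨s.1.1, s.2⟩, s.1.2⟩,
          fun s => ⟨⟨s.1.1, s.2⟩, s.1.2⟩, fun _ => rfl, fun _ => rfl⟩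
        (P.comp (m.op i) (fun j => q j.1)) (fun _ => rfl) }
  relabel_refl m := FreeElt.eq_of (fun _ => rfl) (fun i => by
    refine (P.relabel_trans _ _ _ _ _).trans ?_
    exact Operad.relabel_id (fun _ => rfl) _ _)
  relabel_trans σ τ _ _ _ h h' m := FreeElt.eq_of (fun _ => rfl) (fun i => by
    refine (P.relabel_trans _ _ _ _ _).trans ?_
    refine (P.relabel_trans _ _ _ _ _).trans ?_
    apply Operad.relabel_congr
    intro s
    rfl)
  act_relabel τ c d d' h m q := FreeElt.eq_of (fun _ => rfl) (fun i => by
    refine (P.relabel_trans _ _ _ _ _).trans ?_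
    refine (congrArg (fun r => P.relabel _ r _) (P.comp_relabel (fun j : {j // m.idx j = i} => τ j.1)
      (fun j => h j.1) (m.op i) (fun j => q j.1))).trans ?_
    refine (P.relabel_trans _ _ _ _ _).trans ?_
    refine Eq.trans ?_ (P.relabel_trans _ _ _ _ _).symm
    apply Operad.relabel_congr
    intro s
    rfl)
  relabel_act σ c d m q := FreeElt.eq_of (fun _ => rfl) (fun i => by
    refine (P.relabel_trans _ _ _ _ _).trans ?_
    refine (congrArg (fun r => P.relabel _ r _) (P.relabel_comp
      (σ.subtypeEquiv (p := fun j => m.idx j = i)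
        (q := fun j => m.idx (σ.symm j) = i) (fun j => by rw [σ.symm_apply_apply]))
      (c := fun j => c j.1) (m.op i) (fun j => q j.1))).trans ?_
    refine (P.relabel_trans _ _ _ _ _).trans ?_
    refine Eq.trans ?_ (P.relabel_trans _ _ _ _ _).symm
    apply Operad.relabel_congr
    intro s
    rfl)
  act_act {J K L _ _ _ d k l} m q r := FreeElt.eq_of (fun _ => rfl) (fun i => by
    refine (P.relabel_trans _ _ _ _ _).trans ?_
    refine (P.relabel_trans _ _ _ _ _).trans ?_
    refine (congrArg (fun t => P.relabel _ t _) (P.relabel_comp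
      (⟨fun s => ⟨⟨s.1.1, s.2⟩, s.1.2⟩, fun s => ⟨⟨s.1.1, s.2⟩, s.1.2⟩, fun _ => rfl, fun _ => rfl⟩ :
        (Σ j : {j // m.idx j = i}, K j.1) ≃ {s : Σ j, K j // m.idx s.1 = i})
      (c := fun s => k s.1.1 s.1.2) (P.comp (m.op i) (fun j => q j.1))
      (fun s => r s.1.1 s.1.2))).trans ?_
    refine (P.relabel_trans _ _ _ _ _).trans ?_
    refine (congrArg (fun t => P.relabel _ t _) (Operad.relabel_symm (P.comp_assoc (m.op i)
      (fun j => q j.1) (fun j k => r j.1 k)))).trans ?_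
    refine (P.relabel_trans _ _ _ _ _).trans ?_
    apply Operad.relabel_congr
    intro s
    rfl)
  act_one m := FreeElt.eq_of (fun _ => rfl) (fun i => by
    refine (P.relabel_trans _ _ _ _ _).trans ?_
    refine (P.relabel_trans _ _ _ _ _).trans ?_
    refine Eq.trans ?_ (P.comp_one (m.op i))
    apply Operad.relabel_congr
    intro s
    rfl)

/-- The generator of the free module. -/
noncomputable def freeGen {I : Type} [Finite I] (c : I → P.Col) : (free c).obj c :=
  { idx := fun i => i
    op := fun i => Operad.unitOn ⟨i, rfl⟩ (fun j => Subtype.ext j.2) rfl }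

end RightModule

/-- The object of `fSets_{/NP}` given by a representable `F` and a map `F → N P`, that is, an
element of `(N P)_F`. -/
def representable {P : Operad.{u}} {F : Forest} (a : (forestNerve P).obj (Opposite.op F)) :
    Over (forestNerve P) :=
  Over.mk (uliftYonedaEquiv.{u}.symm a)

/-! The key fact is that a map `X ⟶ N_P M` over `N P` carries little data. Its component in `N P` is
forced, so it amounts to choosing, for each element `x` of `X` at a forest `F`, an element of `M` at
the colours of the roots of `F` in `x`, compatibly with restriction. These families are `Sections`,
and `sectionsEquiv` identifies them with maps into the nerve.

This dictates the left adjoint. An element of `M` at a family of colours is a map to `M` from the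
free module on that family (`freeLift`, `free_hom_ext`). A compatible family is therefore a map to
`M` out of the coproduct of free modules, one for each element of `X`, that identifies the generator
at a restriction of `x` with the restriction of the generator at `x`. Dividing out these
identifications yields `leftAdjointObj`. Forests form a type in `Type 1`, so this coproduct stays
inside `Type (max 1 u)`.

When `X` is a representable `α`, the Yoneda lemma reduces a map over `N P` to a single element of
the nerve over `α`, that is, an element of `M` at the root colours of `α`. So `τ(α)` has the
universal property of the free module on those colours, and following the universal element through
the unit leads to the generator (`exists_iso_free`).

The remaining claims are pointwise. Coproducts of modules are disjoint unions, and these commute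
with the sum over decorations that defines the nerve. The square is cartesian because restricting a
decoration to `ρ(F)` remembers exactly the colours of the roots (`forestNerve_map_rootsInclusion`,
`etaHom_injective`). -/

namespace RightModule

variable {P : Operad.{u}}

/-! ### Coproducts of right modules. -/

/-- The coproduct of a family of right modules, computed pointwise. -/
def sigma {ι : Type w} (M : ι → RightModule.{u, w} P) : RightModule.{u, w} P where
  obj c := Σ k, (M k).obj c
  relabel σ _ _ m h := ⟨m.1, (M m.1).relabel σ m.2 h⟩
  act m q := ⟨m.1, (M m.1).act m.2 q⟩
  relabel_refl m := Sigma.ext rfl (heq_of_eq ((M m.1).relabel_refl m.2))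
  relabel_trans σ τ _ _ _ h h' m := Sigma.ext rfl (heq_of_eq ((M m.1).relabel_trans σ τ h h' m.2))
  act_relabel τ _ _ _ h m q := Sigma.ext rfl (heq_of_eq ((M m.1).act_relabel τ h m.2 q))
  relabel_act σ _ _ m q := Sigma.ext rfl (heq_of_eq ((M m.1).relabel_act σ m.2 q))
  act_act m q r := Sigma.ext rfl (heq_of_eq ((M m.1).act_act m.2 q r))
  act_one m := Sigma.ext rfl (heq_of_eq ((M m.1).act_one m.2))

/-- The inclusion of a summand. -/
def sigmaInj {ι : Type w} (M : ι → RightModule.{u, w} P) (k : ι) : M k ⟶ sigma M :=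
  Hom.mk (fun _ m => ⟨k, m⟩) (fun _ _ _ _ _ => rfl) (fun _ _ => rfl)

/-- The map out of a coproduct given by maps out of the summands. -/
def sigmaDesc {ι : Type w} (M : ι → RightModule.{u, w} P) {N : RightModule.{u, w} P}
    (f : ∀ k, M k ⟶ N) : sigma M ⟶ N :=
  Hom.mk (fun c m => Hom.app (f m.1) c m.2)
    (fun σ _ _ h m => Hom.app_relabel (f m.1) σ h m.2)
    (fun m q => Hom.app_act (f m.1) m.2 q)

/-- `sigma M` is a coproduct of the family `M`. -/
def sigmaIsColimit {ι : Type w} (M : ι → RightModule.{u, w} P) :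
    Limits.IsColimit (Limits.Cofan.mk (sigma M) (sigmaInj M)) :=
  Limits.Cofan.IsColimit.mk _ (fun s => sigmaDesc M s.inj) (fun _ _ => rfl) (fun s f h => by
    refine Hom.ext (funext fun I => funext fun _ => funext fun c => funext fun m => ?_)
    exact congrArg (fun g : M m.1 ⟶ s.pt => Hom.app g c m.2) (h m.1))

theorem hasCoproductsOfShape (ι : Type w) :
    Limits.HasCoproductsOfShape ι (RightModule.{u, w} P) :=
  have (M : ι → RightModule.{u, w} P) : Limits.HasCoproduct M := ⟨⟨⟨_, sigmaIsColimit M⟩⟩⟩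
  ⟨fun _ => Limits.hasColimit_of_iso Discrete.natIsoFunctor⟩

/-! ### Quotients of right modules. -/

/-- A relation on the elements of a right module that is compatible with relabelling and the
action. -/
structure Congruence (M : RightModule.{u, w} P) where
  rel : ∀ {I : Type} [Finite I] (c : I → P.Col), M.obj c → M.obj c → Prop
  rel_relabel : ∀ {I J : Type} [Finite I] [Finite J] (σ : I ≃ J) {c : I → P.Col} {d : J → P.Col}
    (h : ∀ i, d (σ i) = c i) {m n : M.obj c}, rel c m n → rel d (M.relabel σ m h) (M.relabel σ n h)
  rel_act : ∀ {I : Type} {J : I → Type} [Finite I] [∀ i, Finite (J i)] {c : I → P.Col}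
    {d : ∀ i, J i → P.Col} (q : ∀ i, P.Op (d i) (c i)) {m n : M.obj c}, rel c m n →
      rel (fun x : Σ i, J i => d x.1 x.2) (M.act m q) (M.act n q)

/-- The quotient of a right module by (the equivalence relation generated by) a congruence. -/
def quotient (M : RightModule.{u, w} P) (r : M.Congruence) : RightModule.{u, w} P where
  obj c := Quot (r.rel c)
  relabel σ _ _ m h := Quot.map (fun m => M.relabel σ m h) (fun _ _ => r.rel_relabel σ h) m
  act m q := Quot.map (fun m => M.act m q) (fun _ _ => r.rel_act q) m
  relabel_refl := by rintro _ _ _ ⟨m⟩; exact congrArg (Quot.mk _) (M.relabel_refl m)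
  relabel_trans σ τ _ _ _ h h' := by
    rintro ⟨m⟩; exact congrArg (Quot.mk _) (M.relabel_trans σ τ h h' m)
  act_relabel τ _ _ _ h := by
    rintro ⟨m⟩ q; exact congrArg (Quot.mk _) (M.act_relabel τ h m q)
  relabel_act σ _ _ := by rintro ⟨m⟩ q; exact congrArg (Quot.mk _) (M.relabel_act σ m q)
  act_act := by rintro _ _ _ _ _ _ _ _ _ ⟨m⟩ q r; exact congrArg (Quot.mk _) (M.act_act m q r)
  act_one := by rintro _ _ _ ⟨m⟩; exact congrArg (Quot.mk _) (M.act_one m)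

/-- The quotient map. -/
def quotientMk (M : RightModule.{u, w} P) (r : M.Congruence) : M ⟶ M.quotient r :=
  Hom.mk (fun _ m => Quot.mk _ m) (fun _ _ _ _ _ => rfl) (fun _ _ => rfl)

/-- The map out of a quotient given by a map that identifies related elements. -/
def quotientDesc {M N : RightModule.{u, w} P} (r : M.Congruence) (f : M ⟶ N)
    (hf : ∀ {I : Type} [Finite I] (c : I → P.Col) (m n : M.obj c), r.rel c m n →
      Hom.app f c m = Hom.app f c n) : M.quotient r ⟶ N :=
  Hom.mk (fun c => Quot.lift (Hom.app f c) (hf c))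
    (fun σ _ _ h => by rintro ⟨m⟩; exact Hom.app_relabel f σ h m)
    (fun m q => by obtain ⟨m⟩ := m; exact Hom.app_act f m q)

theorem quotient_hom_ext {M N : RightModule.{u, w} P} {r : M.Congruence}
    {f g : M.quotient r ⟶ N} (h : quotientMk M r ≫ f = quotientMk M r ≫ g) : f = g := by
  refine Hom.ext (funext fun I => funext fun _ => funext fun c => funext fun m => ?_)
  obtain ⟨m⟩ := m
  exact congrArg (fun k : M ⟶ N => Hom.app k c m) h

/-! ### The universal property of the free module on one generator. -/

section free

variable {I : Type} [Finite I] {c : I → P.Col}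

/-- The value of the map `free c ⟶ M` that sends the generator to `m`. -/
def freeEval (M : RightModule.{u, w} P) (m : M.obj c) {J : Type} [Finite J] {d : J → P.Col}
    (g : FreeElt c d) : M.obj d :=
  M.relabel (Equiv.sigmaFiberEquiv g.idx) (M.act m g.op) (fun _ => rfl)

/-- The map out of a free module that sends the generator to `m`. -/
def freeLift (M : RightModule.{u, max 1 u} P) (m : M.obj c) : free c ⟶ M :=
  Hom.mk (fun _ g => M.freeEval m g)
    (fun {J K _ _} σ d e h g => by
      -- Relabelling `g` by `σ` relabels each of its operations by the restriction of `σ` to a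
      -- fibre. Inner equivariance pulls these bijections out of the action, and both sides become
      -- relabellings of `M.act m g.op` along the same bijection.
      let τ : ∀ i, {j // g.idx j = i} ≃ {k // g.idx (σ.symm k) = i} := fun i =>
        σ.subtypeEquiv (fun j => by rw [σ.symm_apply_apply])
      have h1 := M.act_relabel τ (d' := fun i k => e k.1) (fun i j => h j.1) m g.op
      refine (congrArg (fun n => M.relabel (Equiv.sigmaFiberEquiv fun k => g.idx (σ.symm k)) n
        (fun _ => rfl)) h1).trans ?_
      refine (M.relabel_trans _ _ _ _ _).trans ?_
      refine Eq.trans ?_ (M.relabel_trans _ _ _ _ _).symm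
      apply M.relabel_congr
      intro s
      rfl)
    (fun {J K _ _ d k} g q => by
      -- The operations of `g` acted on by `q` are composites in `P`, up to this regrouping of
      -- inputs. Once the regrouping is pulled out, associativity turns the action of a composite
      -- into two successive actions.
      let τ : ∀ i, (Σ j : {j // g.idx j = i}, K j.1) ≃ {s : Σ j, K j // g.idx s.1 = i} := fun i =>
        ⟨fun s => ⟨⟨s.1.1, s.2⟩, s.1.2⟩, fun s => ⟨⟨s.1.1, s.2⟩, s.1.2⟩, fun _ => rfl, fun _ => rfl⟩
      have h1 := M.act_relabel τ (d' := fun i s => k s.1.1 s.1.2) (fun _ _ => rfl) m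
        (fun i => P.comp (g.op i) (fun j => q j.1))
      refine (congrArg (fun n => M.relabel (Equiv.sigmaFiberEquiv fun s : Σ j, K j => g.idx s.1) n
        (fun _ => rfl)) h1).trans ?_
      refine (M.relabel_trans _ _ _ _ _).trans ?_
      have h2 := M.act_act m g.op (fun i j => q j.1)
      refine (congrArg (fun n => M.relabel _ n _) h2.symm).trans ?_
      refine (M.relabel_trans _ _ _ _ _).trans ?_
      symm
      refine (M.relabel_act (Equiv.sigmaFiberEquiv g.idx) (c := d) (M.act m g.op) q).trans ?_
      apply M.relabel_congr
      -- On explicit tuples both bijections send the input to `⟨j, s⟩`.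
      rintro ⟨⟨i, j, hj⟩, s⟩
      rfl)

/-- The operations of the generator are identities, with inputs renamed from `Unit` to the one-point
fibres of the identity map; hence this is the unit law of the action. -/
theorem freeLift_gen (M : RightModule.{u, max 1 u} P) (m : M.obj c) :
    Hom.app (freeLift M m) c (freeGen c) = m := by
  refine (congrArg (fun n => M.relabel (Equiv.sigmaFiberEquiv fun i => i) n (fun _ => rfl))
    (M.act_relabel (fun i => (⟨fun _ => ⟨i, rfl⟩, fun _ => (), fun _ => rfl,
      fun j => Subtype.ext j.2.symm⟩ : Unit ≃ {j : I // j = i})) (d' := fun _ j => c j.1)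
      (fun _ _ => rfl) m (fun i => P.one (c i)))).trans ?_
  refine (M.relabel_trans _ _ _ _ _).trans ?_
  refine Eq.trans ?_ (M.act_one m)
  apply M.relabel_congr
  intro s
  rfl

/-- This says that the generator generates, which is the uniqueness half of the universal property.
Over each `i` the operation on the left is an identity followed by the operation of `g`, so
`comp_unitOn` applies. -/
theorem freeEval_gen {J : Type} [Finite J] {d : J → P.Col} (g : FreeElt c d) :
    (free c).freeEval (freeGen c) g = g := by
  refine FreeElt.eq_of (fun j => rfl) (fun i => ?_)
  refine (P.relabel_trans _ _ _ _ _).trans ?_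
  refine (P.relabel_trans _ _ _ _ _).trans ?_
  -- The identity has the single input `i`, so the inputs of the composite are those of `g.op i`.
  let σ : {j // g.idx j = i} ≃ Σ k : {k : I // k = i}, {j // g.idx j = k.1} :=
    ⟨fun j => ⟨⟨i, rfl⟩, j⟩, fun s => ⟨s.2.1, s.2.2.trans s.1.2⟩, fun _ => rfl, by
      rintro ⟨⟨k, rfl⟩, j⟩
      rfl⟩
  refine (congrArg (fun n => P.relabel _ n _) (Operad.comp_unitOn (P := P)
    (⟨i, rfl⟩ : {k : I // k = i}) (fun j => Subtype.ext j.2) (c := fun k => c k.1)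
    (fun k => g.op k.1) σ (fun _ => rfl))).trans ?_
  refine (P.relabel_trans _ _ _ _ _).trans ?_
  exact Operad.relabel_id (fun _ => rfl) _ _

theorem app_freeEval {M N : RightModule.{u, w} P} (f : M ⟶ N) (m : M.obj c) {J : Type} [Finite J]
    {d : J → P.Col} (g : FreeElt c d) :
    Hom.app f d (M.freeEval m g) = N.freeEval (Hom.app f c m) g :=
  (Hom.app_relabel f _ _ _).trans (congrArg (fun n => N.relabel (Equiv.sigmaFiberEquiv g.idx) n
    (fun _ => rfl)) (Hom.app_act f m g.op))

theorem free_hom_app {M : RightModule.{u, max 1 u} P} (f : free c ⟶ M) {J : Type} [Finite J]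
    {d : J → P.Col} (g : FreeElt c d) :
    Hom.app f d g = M.freeEval (Hom.app f c (freeGen c)) g :=
  (congrArg (Hom.app f d) (freeEval_gen g)).symm.trans (app_freeEval f _ g)

/-- Every element is obtained from the generator by the action and relabelling, and module maps
preserve both. -/
theorem free_hom_ext {M : RightModule.{u, max 1 u} P} {f g : free c ⟶ M}
    (h : Hom.app f c (freeGen c) = Hom.app g c (freeGen c)) : f = g := by
  refine Hom.ext (funext fun J => funext fun _ => funext fun d => funext fun m => ?_)
  refine (free_hom_app f m).trans (Eq.trans ?_ (free_hom_app g m).symm)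
  rw [h]

end free

/-! ### Comparing module elements over equal families of colours. -/

/-- Transport of an element along an equality of families of colours. -/
def recolour (M : RightModule.{u, w} P) {I : Type} [Finite I] {c d : I → P.Col} (h : c = d)
    (m : M.obj c) : M.obj d :=
  M.relabel (Equiv.refl I) m (fun i => (congrFun h i).symm)

theorem recolour_rfl (M : RightModule.{u, w} P) {I : Type} [Finite I] {c : I → P.Col}
    (m : M.obj c) : M.recolour rfl m = m :=
  M.relabel_refl m

theorem app_recolour {M N : RightModule.{u, w} P} (f : M ⟶ N) {I : Type} [Finite I]
    {c d : I → P.Col} (h : c = d) (m : M.obj c) :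
    Hom.app f d (M.recolour h m) = N.recolour h (Hom.app f c m) :=
  Hom.app_relabel f _ _ m

/-- The module component has a type depending on the decoration. Phrasing its equality through
`recolour` replaces heterogeneous equality by a relabelling along the identity, with which module
maps commute. -/
theorem nerve_ext {M : RightModule.{u, max 1 u} P} {F : Forest}
    {s t : Σ a : (forestNerve P).obj (Opposite.op F), M.obj (fun i => Forest.colour a (F.root i))}
    (h : s.1 = t.1) (h' : M.recolour (by rw [h]) s.2 = t.2) : s = t := by
  obtain ⟨a, m⟩ := s
  obtain ⟨b, n⟩ := t
  obtain rfl : a = b := h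
  obtain rfl : m = n := (M.recolour_rfl m).symm.trans h'
  rfl

theorem nerve_snd_eq {M : RightModule.{u, max 1 u} P} {F : Forest}
    {s t : Σ a : (forestNerve P).obj (Opposite.op F), M.obj (fun i => Forest.colour a (F.root i))}
    (h : s = t) : M.recolour (by rw [h]) s.2 = t.2 := by
  subst h
  exact M.recolour_rfl _

end RightModule

/-! ### Maps into the nerve as compatible families. -/

namespace ModuleNerve

variable {P : Operad.{u}} (hP : P.IsClosed) (X : Over (forestNerve P))

/-- The `P`-decoration underlying an element of an object over the nerve of `P`. -/
def dec {X : Over (forestNerve P)} {F : Forest} (x : X.left.obj (Opposite.op F)) :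
    (forestNerve P).obj (Opposite.op F) :=
  X.hom.app (Opposite.op F) x

theorem dec_map {X : Over (forestNerve P)} {F G : Forest} (φ : F ⟶ G)
    (x : X.left.obj (Opposite.op G)) :
    dec (X.left.map φ.op x) = (forestNerve P).map φ.op (dec x) :=
  NatTrans.naturality_apply X.hom φ.op x

/-- The colours of the roots of an element of an object over the nerve of `P`. -/
abbrev rootColours {X : Over (forestNerve P)} {F : Forest} (x : X.left.obj (Opposite.op F)) :
    F.Idx → P.Col :=
  fun i => Forest.colour (dec x) (F.root i)

/-- The equality comes from naturality of `X ⟶ N P` and is only propositional; this is why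
`restrict` recolours the result of `pull`. -/
theorem rootColours_map {X : Over (forestNerve P)} {F G : Forest} (φ : F ⟶ G)
    (x : X.left.obj (Opposite.op G)) :
    (fun i => Forest.colour (dec x) (Forest.Hom.edge φ (F.root i))) =
      rootColours (X.left.map φ.op x) := by
  funext i
  have := dec_map φ x
  exact congrArg (fun a : (forestNerve P).obj (Opposite.op F) => Forest.colour a (F.root i))
    this.symm

/-- The restriction along `φ` of an element of `M` at the root colours of `x`. -/
noncomputable def restrict (M : RightModule.{u, max 1 u} P) {X : Over (forestNerve P)} {F G : Forest}
    (φ : F ⟶ G) (x : X.left.obj (Opposite.op G)) (m : M.obj (rootColours x)) :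
    M.obj (rootColours (X.left.map φ.op x)) :=
  M.recolour (rootColours_map φ x) (M.pull hP φ (dec x) m)

theorem app_restrict {M N : RightModule.{u, max 1 u} P} (f : M ⟶ N) {X : Over (forestNerve P)}
    {F G : Forest} (φ : F ⟶ G) (x : X.left.obj (Opposite.op G)) (m : M.obj (rootColours x)) :
    RightModule.Hom.app f _ (restrict hP M φ x m) =
      restrict hP N φ x (RightModule.Hom.app f _ m) :=
  (RightModule.app_recolour f _ _).trans
    (congrArg (N.recolour _) (RightModule.pull_app hP f φ (dec x) m))

/-- Families of elements of `M` at the root colours of the elements of `X`, compatible with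
restriction. -/
@[ext]
structure Sections (M : RightModule.{u, max 1 u} P) where
  val : ∀ {F : Forest} (x : X.left.obj (Opposite.op F)), M.obj (rootColours x)
  val_map : ∀ {F G : Forest} (φ : F ⟶ G) (x : X.left.obj (Opposite.op G)),
    restrict hP M φ x (val x) = val (X.left.map φ.op x)

variable {X}

/-- A morphism over `N P` cannot change the decoration, so its only freedom lies in the module
component. -/
theorem homLeft_fst {M : RightModule.{u, max 1 u} P} (η : X ⟶ (moduleNerve hP).obj M) {F : Forest}
    (x : X.left.obj (Opposite.op F)) :
    (η.left.app (Opposite.op F) x).1 = dec x :=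
  congrArg (fun f : X.left ⟶ forestNerve P => f.app (Opposite.op F) x) (Over.w η)

/-- The element of `M` at the root colours of `x` given by a map into the nerve of `M`. -/
noncomputable def homVal {M : RightModule.{u, max 1 u} P} (η : X ⟶ (moduleNerve hP).obj M)
    {F : Forest} (x : X.left.obj (Opposite.op F)) : M.obj (rootColours x) :=
  M.recolour (by rw [homLeft_fst]) (η.left.app (Opposite.op F) x).2

theorem homVal_eq {M : RightModule.{u, max 1 u} P} (η : X ⟶ (moduleNerve hP).obj M)
    {F : Forest} (x : X.left.obj (Opposite.op F)) {m : M.obj (rootColours x)}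
    (h : η.left.app (Opposite.op F) x = ⟨dec x, m⟩) : homVal hP η x = m :=
  RightModule.nerve_snd_eq h

theorem homLeft_eq {M : RightModule.{u, max 1 u} P} (η : X ⟶ (moduleNerve hP).obj M)
    {F : Forest} (x : X.left.obj (Opposite.op F)) :
    η.left.app (Opposite.op F) x = ⟨dec x, homVal hP η x⟩ :=
  RightModule.nerve_ext (F := F) (homLeft_fst hP η x) rfl

theorem nerve_map {M : RightModule.{u, max 1 u} P} {F G : Forest} (φ : F ⟶ G)
    (x : X.left.obj (Opposite.op G)) (m : M.obj (rootColours x)) :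
    ((moduleNerve hP).obj M).left.map φ.op ⟨dec x, m⟩ =
      ⟨dec (X.left.map φ.op x), restrict hP M φ x m⟩ :=
  RightModule.nerve_ext (F := F) (dec_map φ x).symm rfl

/-- Maps into the nerve of `M` over the nerve of `P` are compatible families. -/
noncomputable def sectionsEquiv (M : RightModule.{u, max 1 u} P) :
    Sections hP X M ≃ (X ⟶ (moduleNerve hP).obj M) where
  toFun s := Over.homMk
    { app := fun F => ↾ fun x => ⟨dec (F := F.unop) x, s.val (F := F.unop) x⟩
      naturality := fun F G φ => by
        apply ConcreteCategory.hom_ext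
        intro x
        refine Eq.trans ?_ (nerve_map hP φ.unop x (s.val x)).symm
        -- The decorations already agree, so naturality is exactly compatibility of the family.
        exact congrArg (Sigma.mk _) (s.val_map φ.unop x).symm }
    (by
      ext F
      rfl)
  invFun η :=
    { val := homVal hP η
      val_map := fun {F G} φ x => by
        refine (homVal_eq hP η _ ?_).symm
        refine (NatTrans.naturality_apply η.left φ.op x).trans ?_
        refine Eq.trans ?_ (nerve_map hP φ x (homVal hP η x))
        exact congrArg (((moduleNerve hP).obj M).left.map φ.op) (homLeft_eq hP η x) }
  left_inv s := by
    ext F x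
    exact homVal_eq hP _ _ rfl
  right_inv η := by
    refine Over.OverMorphism.ext (NatTrans.ext (funext fun F => ?_))
    apply ConcreteCategory.hom_ext
    intro x
    exact (homLeft_eq hP η (F := F.unop) x).symm

/-! ### The left adjoint by generators and relations. -/

variable (X)

/-- The coproduct of the free modules on the root colours of all the elements of `X`. -/
abbrev generated : RightModule.{u, max 1 u} P :=
  RightModule.sigma (ι := Σ F : Forest, X.left.obj (Opposite.op F))
    (fun x => RightModule.free (rootColours x.2))

/-- The inclusion of the free module on the root colours of `x`. -/
abbrev generatedInj {F : Forest} (x : X.left.obj (Opposite.op F)) :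
    RightModule.free (rootColours x) ⟶ generated X :=
  RightModule.sigmaInj (fun x : Σ F : Forest, X.left.obj (Opposite.op F) =>
    RightModule.free (rootColours x.2)) ⟨F, x⟩

/-- The map between free modules given by a morphism of forests. -/
noncomputable def freeRestrict {F G : Forest} (φ : F ⟶ G) (x : X.left.obj (Opposite.op G)) :
    RightModule.free (rootColours (X.left.map φ.op x)) ⟶ RightModule.free (rootColours x) :=
  RightModule.freeLift _ (restrict hP _ φ x (RightModule.freeGen _))

/-- The relation that identifies the generator at a restriction of `x` with the restriction of
the generator at `x`. -/
inductive RestrictRel {I : Type} [Finite I] (c : I → P.Col) :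
    (generated X).obj c → (generated X).obj c → Prop
  | mk {F G : Forest} (φ : F ⟶ G) (x : X.left.obj (Opposite.op G))
      (g : (RightModule.free (rootColours (X.left.map φ.op x))).obj c) :
      RestrictRel c (RightModule.Hom.app (generatedInj X (X.left.map φ.op x)) c g)
        (RightModule.Hom.app (freeRestrict hP X φ x ≫ generatedInj X x) c g)

/-- `RestrictRel` as a congruence. -/
def restrictCongruence : (generated X).Congruence where
  rel c := RestrictRel hP X c
  rel_relabel σ c d h m n := by
    rintro ⟨φ, x, g⟩
    -- Related elements are the images of one free element `g` under two module maps, so relabelling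
    -- them only replaces `g` by its relabelling. The same argument handles the action.
    rw [← RightModule.Hom.app_relabel, ← RightModule.Hom.app_relabel]
    exact .mk φ x _
  rel_act q m n := by
    rintro ⟨φ, x, g⟩
    rw [← RightModule.Hom.app_act, ← RightModule.Hom.app_act]
    exact .mk φ x _

/-- The value at `X` of the left adjoint of the nerve of right modules. -/
noncomputable def leftAdjointObj : RightModule.{u, max 1 u} P :=
  (generated X).quotient (restrictCongruence hP X)

/-- The map from the free module on the root colours of `x`. -/
noncomputable def leftAdjointInj {F : Forest} (x : X.left.obj (Opposite.op F)) :
    RightModule.free (rootColours x) ⟶ leftAdjointObj hP X :=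
  generatedInj X x ≫ RightModule.quotientMk _ _

theorem freeRestrict_leftAdjointInj {F G : Forest} (φ : F ⟶ G)
    (x : X.left.obj (Opposite.op G)) :
    freeRestrict hP X φ x ≫ leftAdjointInj hP X x = leftAdjointInj hP X (X.left.map φ.op x) := by
  refine RightModule.Hom.ext (funext fun I => funext fun _ => funext fun c => funext fun g => ?_)
  exact (Quot.sound (RestrictRel.mk φ x g)).symm

/-- The quotient map is epi, maps out of a coproduct are tested on summands, and maps out of a free
module on its generator. -/
theorem leftAdjointObj_hom_ext {M : RightModule.{u, max 1 u} P} {f g : leftAdjointObj hP X ⟶ M}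
    (h : ∀ {F : Forest} (x : X.left.obj (Opposite.op F)),
      RightModule.Hom.app (leftAdjointInj hP X x ≫ f) _ (RightModule.freeGen _) =
        RightModule.Hom.app (leftAdjointInj hP X x ≫ g) _ (RightModule.freeGen _)) : f = g := by
  apply RightModule.quotient_hom_ext
  refine Limits.Cofan.IsColimit.hom_ext (RightModule.sigmaIsColimit _) _ _ ?_
  rintro ⟨F, x⟩
  exact RightModule.free_hom_ext (h x)

variable {X}

/-- The map given by a compatible family. -/
noncomputable def leftAdjointDesc {M : RightModule.{u, max 1 u} P} (s : Sections hP X M) :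
    leftAdjointObj hP X ⟶ M :=
  RightModule.quotientDesc _ (RightModule.sigmaDesc _ fun x => RightModule.freeLift M (s.val x.2))
    (by
      rintro I _ c _ _ ⟨φ, x, g⟩
      -- Both maps start at a free module, so it suffices to compare them on the generator, where
      -- the equality is the compatibility `s.val_map`.
      have h : RightModule.freeLift M (s.val (X.left.map φ.op x)) =
          freeRestrict hP X φ x ≫ RightModule.freeLift M (s.val x) := by
        apply RightModule.free_hom_ext
        refine (RightModule.freeLift_gen _ _).trans ?_
        refine Eq.trans ?_ (congrArg (RightModule.Hom.app (RightModule.freeLift M (s.val x)) _)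
          (RightModule.freeLift_gen _ _)).symm
        refine Eq.trans ?_ (app_restrict hP _ φ x _).symm
        refine (s.val_map φ x).symm.trans (congrArg (restrict hP M φ x) ?_)
        exact (RightModule.freeLift_gen _ _).symm
      exact congrArg (fun f => RightModule.Hom.app f c g) h)

/-- Maps out of the value of the left adjoint are compatible families. -/
noncomputable def leftAdjointObjEquiv (M : RightModule.{u, max 1 u} P) :
    (leftAdjointObj hP X ⟶ M) ≃ Sections hP X M where
  toFun f :=
    { val := fun x => RightModule.Hom.app (leftAdjointInj hP X x ≫ f) _ (RightModule.freeGen _)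
      val_map := fun φ x => by
        -- Module maps commute with restriction, so it is enough that in the quotient the restricted
        -- generator is the generator of the restriction.
        rw [← app_restrict, ← freeRestrict_leftAdjointInj, Category.assoc]
        exact (congrArg (RightModule.Hom.app (leftAdjointInj hP X x ≫ f) _)
          (RightModule.freeLift_gen _ _)).symm }
  invFun s := leftAdjointDesc hP s
  left_inv f := leftAdjointObj_hom_ext hP X fun x => RightModule.freeLift_gen _ _
  right_inv s := by
    ext F x
    exact RightModule.freeLift_gen _ _

/-- A bijection natural in `M` suffices, since it determines how the left adjoint acts on morphisms.
Naturality is definitional because both sides evaluate at the generators and then apply the module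
map. -/
theorem isRightAdjoint : (moduleNerve hP).IsRightAdjoint :=
  (Adjunction.adjunctionOfEquivLeft (G := moduleNerve hP) (F_obj := leftAdjointObj hP)
    (fun _ M => (leftAdjointObjEquiv hP M).trans (sectionsEquiv hP M))
    (fun _ _ _ _ _ => rfl)).isRightAdjoint

/-! ### The nerve preserves coproducts. -/

/-- The nerve sends the coproduct `RightModule.sigma` to a coproduct. -/
noncomputable def moduleNerveSigmaIsColimit {ι : Type (max 1 u)}
    (M : ι → RightModule.{u, max 1 u} P) :
    Limits.IsColimit (Limits.Cofan.mk ((moduleNerve hP).obj (RightModule.sigma M))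
      (fun k => (moduleNerve hP).map (RightModule.sigmaInj M k))) :=
  Limits.Cofan.IsColimit.mk _
    (fun s => Over.homMk
      -- An element over a decoration lies in exactly one summand `k`, as restriction never changes
      -- `k`. Exchanging the sum over decorations with the sum over `k` gives the descent map.
      { app := fun F => ↾ fun x => (s.inj x.2.1).left.app F ⟨x.1, x.2.2⟩
        naturality := fun F G φ => by
          apply ConcreteCategory.hom_ext
          rintro ⟨a, k, m⟩
          exact NatTrans.naturality_apply (s.inj k).left φ ⟨a, m⟩ }
      (by
        refine NatTrans.ext (funext fun F => ConcreteCategory.hom_ext _ _ ?_)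
        rintro ⟨a, k, m⟩
        exact congrArg (fun f : ((moduleNerve hP).obj (M k)).left ⟶ forestNerve P =>
          f.app F ⟨a, m⟩) (Over.w (s.inj k))))
    (fun _ _ => rfl)
    (fun s f h => by
      refine Over.OverMorphism.ext (NatTrans.ext (funext fun F => ConcreteCategory.hom_ext _ _ ?_))
      rintro ⟨a, k, m⟩
      exact congrArg (fun g : (moduleNerve hP).obj (M k) ⟶ s.pt => g.left.app F ⟨a, m⟩) (h k))

/-- It suffices that one colimit cocone, here `RightModule.sigma`, is sent to a colimit cocone. -/
theorem preservesCoproductsOfShape (ι : Type (max 1 u)) :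
    Limits.PreservesColimitsOfShape (Discrete ι) (moduleNerve hP) :=
  have (M : ι → RightModule.{u, max 1 u} P) :
      Limits.PreservesColimit (Discrete.functor M) (moduleNerve hP) :=
    Limits.preservesColimit_of_preserves_colimit_cocone (RightModule.sigmaIsColimit M)
      ((Limits.isColimitMapCoconeCofanMkEquiv _ _ _).symm (moduleNerveSigmaIsColimit hP M))
  Limits.preservesColimitsOfShape_of_discrete _

/-! ### Representable objects and free modules. -/

variable {F : Forest}
  (a : (forestNerve P).obj (Opposite.op F))

/-- The universal element of a representable object. -/
abbrev universalElt : (representable a).left.obj (Opposite.op F) := ⟨𝟙 F⟩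

theorem dec_universalElt : dec (universalElt a) = a :=
  uliftYonedaEquiv.{u}.apply_symm_apply a

/-- The Yoneda lemma, together with the fact that a map in the over category is determined by its
underlying map. -/
theorem representable_hom_ext {Y : Over (forestNerve P)} {f g : representable a ⟶ Y}
    (h : f.left.app (Opposite.op F) (universalElt a) =
      g.left.app (Opposite.op F) (universalElt a)) : f = g :=
  Over.OverMorphism.ext (uliftYonedaEquiv.{u}.injective h)

/-- The map from a representable object given by an element over `a`. -/
noncomputable def representableHom {Y : Over (forestNerve P)} (y : Y.left.obj (Opposite.op F))
    (h : dec y = a) : representable a ⟶ Y :=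
  Over.homMk (uliftYonedaEquiv.{u}.symm y) (by
    apply uliftYonedaEquiv.{u}.injective
    refine Eq.trans ?_ (dec_universalElt a).symm
    refine Eq.trans ?_ h
    exact congrArg (dec (X := Y)) (uliftYonedaEquiv.{u}.apply_symm_apply y))

theorem representableHom_universalElt {Y : Over (forestNerve P)}
    (y : Y.left.obj (Opposite.op F)) (h : dec y = a) :
    (representableHom a y h).left.app (Opposite.op F) (universalElt a) = y :=
  uliftYonedaEquiv.{u}.apply_symm_apply y

theorem exists_iso_free (τ : Over (forestNerve P) ⥤ RightModule.{u, max 1 u} P)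
    (adj : τ ⊣ moduleNerve hP) :
    ∃ e : τ.obj (representable a) ≅ RightModule.free (fun i => Forest.colour a (F.root i)),
      ((moduleNerve hP).map e.hom).left.app (Opposite.op F)
          ((adj.unit.app (representable a)).left.app (Opposite.op F) (universalElt a)) =
        ⟨a, RightModule.freeGen (fun i => Forest.colour a (F.root i))⟩ := by
  let N := RightModule.free (fun i => Forest.colour a (F.root i))
  let gen : N.obj _ := RightModule.freeGen (fun i => Forest.colour a (F.root i))
  -- `ev f` is the element of the nerve that names `f` under the adjunction and the Yoneda lemma.
  -- Maps out of `τ(α)` can hence be compared by their `ev`.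
  let ev {M : RightModule.{u, max 1 u} P} (f : τ.obj (representable a) ⟶ M) :=
    ((moduleNerve hP).map f).left.app (Opposite.op F)
      ((adj.unit.app (representable a)).left.app (Opposite.op F) (universalElt a))
  have ev_eq {M : RightModule.{u, max 1 u} P} (f : τ.obj (representable a) ⟶ M) :
      ev f = (adj.homEquiv _ _ f).left.app (Opposite.op F) (universalElt a) := by
    rw [adj.homEquiv_unit]
    rfl
  have ev_inj {M : RightModule.{u, max 1 u} P} {f g : τ.obj (representable a) ⟶ M}
      (h : ev f = ev g) : f = g := by
    apply (adj.homEquiv _ _).injective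
    apply representable_hom_ext
    rw [← ev_eq, ← ev_eq, h]
  obtain ⟨m, hm⟩ : ∃ m : (τ.obj (representable a)).obj (fun i => Forest.colour a (F.root i)),
      ev (𝟙 _) = ⟨a, m⟩ := by
    obtain ⟨⟨b, m⟩, h⟩ : ∃ s, ev (𝟙 (τ.obj (representable a))) = s := ⟨_, rfl⟩
    -- The unit is a map over `N P`, so the image of the universal element has decoration `a`; its
    -- module component `m` is the candidate generator of `τ(α)`.
    obtain rfl : b = a := by
      have h1 := homLeft_fst hP (adj.homEquiv _ _ (𝟙 _)) (universalElt a)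
      rw [← ev_eq, h, dec_universalElt] at h1
      exact h1
    exact ⟨m, h⟩
  have ev_app {M : RightModule.{u, max 1 u} P} (f : τ.obj (representable a) ⟶ M) :
      ev f = ⟨a, RightModule.Hom.app f _ m⟩ :=
    (congrArg (((moduleNerve hP).map f).left.app (Opposite.op F)) hm)
  -- `p` is the transpose of the map naming `(a, gen)`, so it sends `m` to the generator. The map
  -- `q` below sends the generator to `m`. Both composites are then identities, by the uniqueness
  -- property on each side.
  let p : τ.obj (representable a) ⟶ N := (adj.homEquiv _ _).symm
    (representableHom a (Y := (moduleNerve hP).obj N) ⟨a, gen⟩ rfl)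
  have hp : ev p = ⟨a, gen⟩ := by
    rw [ev_eq]
    simp only [p, Equiv.apply_symm_apply]
    exact representableHom_universalElt a _ _
  have hpm : RightModule.Hom.app p _ m = gen :=
    eq_of_heq (Sigma.mk.inj ((ev_app p).symm.trans hp)).2
  let q : N ⟶ τ.obj (representable a) := RightModule.freeLift _ m
  have hq : RightModule.Hom.app q _ gen = m := RightModule.freeLift_gen _ m
  refine ⟨⟨p, q, ev_inj ?_, RightModule.free_hom_ext ?_⟩, hp⟩
  · rw [ev_app, ev_app]
    exact congrArg (Sigma.mk a) ((congrArg (RightModule.Hom.app q _) hpm).trans hq)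
  · exact (congrArg (RightModule.Hom.app p _) hq).trans hpm

/-! ### The cartesian square over the forest of roots. -/

theorem _root_.Operad.Hom.op_unitOn {Q : Operad.{w}} (b : Operad.Hom Q P) {I : Type} [Finite I]
    (i : I) (hi : ∀ j, j = i) {c : I → Q.Col} {e : Q.Col} (hc : c i = e) :
    b.op (Operad.unitOn i hi hc) = Operad.unitOn i hi (congrArg b.col hc) := by
  unfold Operad.unitOn
  rw [b.op_relabel, b.op_one]

/-- The map `etaHom e` takes only identities as values, up to renaming the input, and operad maps
preserve these. Thus restricting a decoration to a root keeps only its colour. -/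
theorem _root_.OperadicTree.comp_etaHom {T : OperadicTree} (b : Operad.Hom T.operad P)
    (e : T.Edge) : b.comp (OperadicTree.etaHom (P := T.operad) e) =
      OperadicTree.etaHom (b.col e) := by
  unfold Operad.Hom.comp OperadicTree.etaHom
  rw [Operad.Hom.mk.injEq]
  refine ⟨rfl, heq_of_eq ?_⟩
  funext I _ c d p
  exact b.op_unitOn _ _ rfl

theorem forestNerve_map_rootsInclusion :
    (forestNerve P).map F.rootsInclusion.op a =
      fun i => OperadicTree.etaHom (Forest.colour a (F.root i)) :=
  funext fun i => OperadicTree.comp_etaHom (a i) (F.tree i).root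

theorem etaHom_injective :
    Function.Injective (OperadicTree.etaHom : P.Col → Operad.Hom OperadicTree.eta.operad P) :=
  fun _ _ h => congrFun (congrArg Operad.Hom.col h) ()

/-- Both maps into `(N P)_{ρ(F)}` are families of maps `etaHom`, and `etaHom` is injective. An
element of `M(c)` and a decoration `a` thus match exactly when `c` is the family of root colours of
`a`, and such a pair is an element of the nerve. -/
theorem isPullback (M : RightModule.{u, max 1 u} P) (F : Forest) :
    IsPullback (↾ (RightModule.nerveToTotal hP M F))
      (((moduleNerve hP).obj M).hom.app (Opposite.op F))
      (↾ (M.totalToNerve F)) ((forestNerve P).map F.rootsInclusion.op) := by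
  refine (Limits.Types.isPullback_iff _ _ _ _).2 ⟨?_, ?_, ?_⟩
  · refine ConcreteCategory.hom_ext _ _ ?_
    rintro ⟨a, m⟩
    exact (forestNerve_map_rootsInclusion a).symm
  · rintro ⟨a, m⟩ ⟨b, n⟩ ⟨h1, h2⟩
    obtain rfl : a = b := h2
    have h1 : (⟨_, m⟩ : M.total F.Idx) = ⟨_, n⟩ := h1
    exact congrArg (Sigma.mk a) (eq_of_heq (Sigma.mk.inj h1).2)
  · rintro ⟨c, m⟩ a h
    have h := h.trans (forestNerve_map_rootsInclusion a)
    -- Matching in `(N P)_{ρ(F)}` forces the colours of `m` to be the root colours of `a`, after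
    -- which `⟨a, m⟩` is well typed.
    obtain rfl : c = fun i => Forest.colour a (F.root i) :=
      funext fun i => etaHom_injective (congrFun h i)
    exact ⟨⟨a, m⟩, rfl, rfl⟩

end ModuleNerve

theorem mainTheorem12 (P : Operad.{u}) (hP : P.IsClosed) :
    -- the value of `N_P M` at `F` is the pullback of `M(ρ(F))` along `(N P)_F → (N P)_{ρ(F)}`
    (∀ (M : RightModule.{u, max 1 u} P) (F : Forest),
      IsPullback (↾ (RightModule.nerveToTotal hP M F))
        (((moduleNerve hP).obj M).hom.app (Opposite.op F))
        (↾ (M.totalToNerve F)) ((forestNerve P).map F.rootsInclusion.op)) ∧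
    -- `N_P` has a left adjoint
    (moduleNerve hP).IsRightAdjoint ∧
    -- a left adjoint sends a representable `F → N P` to the free right module on its root colours,
    -- in such a way that the unit sends the universal element of `F` to the generator
    (∀ (τ : Over (forestNerve P) ⥤ RightModule.{u, max 1 u} P) (adj : τ ⊣ moduleNerve hP)
      (F : Forest) (a : (forestNerve P).obj (Opposite.op F)),
      ∃ e : τ.obj (representable a) ≅
          RightModule.free (fun i => Forest.colour a (F.root i)),
        ((moduleNerve hP).map e.hom).left.app (Opposite.op F)
            ((adj.unit.app (representable a)).left.app (Opposite.op F) ⟨𝟙 F⟩) =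
          ⟨a, RightModule.freeGen (fun i => Forest.colour a (F.root i))⟩) ∧
    -- coproducts of right modules exist and are preserved by `N_P`
    (∀ ι : Type (max 1 u), Limits.HasCoproductsOfShape ι (RightModule.{u, max 1 u} P) ∧
      Limits.PreservesColimitsOfShape (Discrete ι) (moduleNerve hP)) := by

  exact ⟨ModuleNerve.isPullback hP, ModuleNerve.isRightAdjoint hP,
    fun τ adj _ a => ModuleNerve.exists_iso_free hP a τ adj,
    fun ι => ⟨RightModule.hasCoproductsOfShape ι, ModuleNerve.preservesCoproductsOfShape hP ι⟩⟩
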